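/- **Setting.** Let $\lambda$ be the security parameter; passwords, salts, keys, IVs and cipher blocks are elements of $\{0,1\}^\lambda$. The primitives are ideal: the KDF is a random oracle $\{0,1\}^\lambda\times\{0,1\}^\lambda\to\{0,1\}^\lambda$ on (password, salt); the cipher $\mathcal E$ is an independent uniformly random permutation of $\{0,1\}^\lambda$ for each (key, IV); the authenticated encryption is an independent uniformly random injection $\{0,1\}^\lambda\to\{0,1\}^{a}$ ($a\ge\lambda$) for each (key, IV), whose inverse returns $\bot$ outside its range. The adversary may query all of them, and their inverses, adaptively. **The Shufflecake scheme.** A device has room for $\mathsf{max}\ge 1$ volume headers and has a data section of $N$ physical slices; each holds $S$ blocks, every block with its IV. *Setup* with passwords $P_1,\dots,P_k$ ($k\le\mathsf{max}$) first fills the whole device with uniform noise, then writes a uniform salt $s$ and, for every $i\le k$, with uniform keys $\mathsf{VMK}_i,\mathsf{VEK}_i$ and fresh uniform IVs: a DMB cell, the authenticated encryption of $\mathsf{VMK}_i$ under $\mathsf{KEK}_i=\mathsf{KDF}(P_i,s)$; a VMB, the encryption under $\mathsf{VMK}_i$ of $\mathsf{VEK}_i$, $\mathsf{VMK}_{i-1}$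 (a random value if $i=1$), $N$ and random filler; and a position map with $N$ entries, initially empty, encrypted under $\mathsf{VEK}_i$. Every encrypted block has its own IV. All the volumes are open, and an array of the $N$ physical slices is shuffled uniformly. A *write* to block $B$ of $V_i$ looks up the logical slice $\lfloor B/S\rfloor$ in the position map; if it is unmapped, it is mapped to the next free physical slice of the shuffled array, i.e. to a uniformly random free one, and the write fails without effect if none is free. Then the data is encrypted under $\mathsf{VEK}_i$ with a fresh IV, and both are stored at offset $B\bmod S$ of the physical slice. A *read* decrypts that block, and returns $0$ if the slice is unmapped; it changes nothing. When the volumes are *closed*, the position maps are encrypted with fresh IVs and written to the disk. **The game.** After oracle queries of its choice, the adversary chooses $1\le\ell\le\mathsf{max}$, the passwords $P_1,\dots,P_{\ell-1}$, and access patterns (finite sequences of reads, writes and empty accesses) $O_0$ on $V_1,\dots,V_\ell$ and $O_1$ on $V_1,\dots,V_{\ell-1}$, such that the decoy volumes $V_1,\dots,V_{\ell-1}$ end with equal logical contents (unwritten blocks counting as $0$) and the sets of blocks of the decoy volumes to which a write has been carried out are equal; a write is carried out unless it needs a new slice when none is free. $D_0$ is the disk after setup with $P_1,\dots,P_\ell$,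 where $P_\ell\in\{0,1\}^\lambda$ is uniform and secret, execution of $O_0$, and closing; $D_1$ is the disk after setup with $P_1,\dots,P_{\ell-1}$, execution of $O_1$, and closing. The adversary $\mathcal A$ is given $D_b$, makes further queries, and outputs a bit. **Theorem 1 (single-snapshot security of Shufflecake).** 1. The scheme is correct: a read always returns the value of the most recent successful write to the same block of the same volume. 2. For every $\lambda$, every device and every adversary $\mathcal A$ (randomised, computationally unbounded) that makes at most $n$ oracle queries in total, $$\bigl|\Pr[\mathcal A(D_0)\to 1]-\Pr[\mathcal A(D_1)\to 1]\bigr|\le 4n\cdot 2^{-\lambda}+T^2\cdot 2^{-\lambda},$$ where $T$ is the number of blocks on the device that can hold a cipher-encrypted block (those of the $\mathsf{max}$ VMBs and position maps, and the $N\cdot S$ data blocks). 3. Consequently the scheme is a single-snapshot-secure plausible-deniability scheme: if $T$ is polynomially bounded in $\lambda$, the advantage of every family of adversaries that make polynomially many oracle queries is negligible in $\lambda$. -/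

import Mathlib

namespace Shufflecake

/-- Bit strings of length `n`. -/
abbrev Word (n : ℕ) : Type := Fin n → Bool

/-- The little-endian `n`-bit encoding of a natural number. -/
def encodeNat (n k : ℕ) : Word n := fun j => k.testBit j

/-- The public layout of a device at security parameter `κ`.  Keys, salts, IVs, passwords and cipher
blocks are all `κ`-bit strings. -/
structure Device (κ : ℕ) where
  /-- the maximal number of volumes -/
  maxVols : ℕ
  /-- the number of physical slices, which is also the number of entries of every position map -/
  numSlices : ℕ
  /-- the number of blocks in a logical slice -/
  sliceLen : ℕ
  /-- the number of filler blocks at the end of the plaintext of a volume master block -/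
  vmbPad : ℕ
  /-- the number of unused blocks at the end of the device master block -/
  dmbPad : ℕ
  /-- the length of an authenticated ciphertext -/
  aeLen : ℕ
  one_le_maxVols : 1 ≤ maxVols
  le_aeLen : κ ≤ aeLen

variable {κ : ℕ}

namespace Device

/-- The number of blocks of a volume master block: the volume encryption key, the master key of the
previous volume, the number of slices, and the filler. -/
abbrev vmbLen (dev : Device κ) : ℕ := dev.vmbPad + 3

/-- Logical block addresses of a volume. -/
abbrev Addr (dev : Device κ) : Type := Fin (dev.numSlices * dev.sliceLen)

/-- The total number of cipher-encrypted blocks that the device has room for: volume master blocks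
and position maps of all the headers, and the data section. -/
def encBlocks (dev : Device κ) : ℕ :=
  dev.maxVols * (dev.vmbLen + dev.numSlices) + dev.numSlices * dev.sliceLen

end Device

/-! ### The ideal primitives -/

/-- The ideal primitives: a random oracle as key derivation function (password, salt), an ideal
cipher (key, IV) and, as authenticated encryption, one injection for each (key, IV). -/
structure Oracles (dev : Device κ) where
  kdf : Word κ → Word κ → Word κ
  cipher : Word κ → Word κ → Equiv.Perm (Word κ)
  ae : Word κ → Word κ → (Word κ ↪ Word dev.aeLen)

/-- An oracle query. -/
inductive Query (dev : Device κ) where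
  | kdf (pw salt : Word κ)
  | enc (key iv block : Word κ)
  | dec (key iv block : Word κ)
  | aeEnc (key iv plain : Word κ)
  | aeDec (key iv : Word κ) (ctxt : Word dev.aeLen)

/-- The type of the answer to a query. -/
abbrev Query.Answer {dev : Device κ} : Query dev → Type
  | .kdf _ _ => Word κ
  | .enc _ _ _ => Word κ
  | .dec _ _ _ => Word κ
  | .aeEnc _ _ _ => Word dev.aeLen
  | .aeDec _ _ _ => Option (Word κ)

/-- The answer of the oracles to a query.  Authenticated decryption fails (`none`) outside of the
range of the injection. -/
noncomputable def Oracles.answer {dev : Device κ} (O : Oracles dev) : (q : Query dev) → q.Answer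
  | .kdf pw salt => O.kdf pw salt
  | .enc key iv x => O.cipher key iv x
  | .dec key iv y => (O.cipher key iv).symm y
  | .aeEnc key iv x => O.ae key iv x
  | .aeDec key iv c => Function.partialInv (O.ae key iv) c

/-! ### Randomised computations with oracle access -/

/-- Computations that may toss fair coins and query the oracles adaptively. -/
inductive OracleComp (dev : Device κ) (α : Type) : Type where
  | pure (a : α) : OracleComp dev α
  | coin (k : Bool → OracleComp dev α) : OracleComp dev α
  | query (q : Query dev) (k : q.Answer → OracleComp dev α) : OracleComp dev α

namespace OracleComp

variable {dev : Device κ} {α : Type}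

/-- The distribution of the result when the queries are answered by `O`. -/
noncomputable def run (O : Oracles dev) : OracleComp dev α → PMF α
  | .pure a => PMF.pure a
  | .coin k => (PMF.uniformOfFintype Bool).bind fun b => (k b).run O
  | .query q k => (k (O.answer q)).run O

/-- `c.Within post n`: on every path at most `n` queries are made, and if the path ends with the
result `a` and `m` of the `n` queries are left, then `post a m` holds. -/
def Within (post : α → ℕ → Prop) : OracleComp dev α → ℕ → Prop
  | .pure a, n => post a n
  | .coin k, n => ∀ b, (k b).Within post n
  | .query _ _, 0 => False
  | .query _ k, n + 1 => ∀ r, (k r).Within post n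

end OracleComp

/-! ### The disk and the randomness of the scheme -/

/-- The whole content of the physical disk.  A pair consists of an IV and a ciphertext. -/
structure Disk (dev : Device κ) where
  /-- the salt, at the start of the device master block (DMB) -/
  salt : Word κ
  /-- the DMB cells -/
  cell : Fin dev.maxVols → Word κ × Word dev.aeLen
  /-- the unused rest of the DMB -/
  dmbRest : Fin dev.dmbPad → Word κ
  /-- the volume master blocks (VMBs) -/
  vmb : Fin dev.maxVols → Fin dev.vmbLen → Word κ × Word κ
  /-- the position maps -/
  posMap : Fin dev.maxVols → Fin dev.numSlices → Word κ × Word κ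
  /-- the data section: the blocks of the physical slices and their IVs -/
  data : Fin dev.numSlices → Fin dev.sliceLen → Word κ × Word κ

/-- The randomness for the creation of one volume. -/
structure VolCoins (dev : Device κ) where
  /-- the volume master key -/
  vmk : Word κ
  /-- the volume encryption key -/
  vek : Word κ
  cellIV : Word κ
  vmbIV : Fin dev.vmbLen → Word κ
  vmbFill : Fin dev.vmbPad → Word κ
  mapIV : Fin dev.numSlices → Word κ

/-- The randomness of `setup`.  The coins of volumes that are not created are left unused. -/
structure SetupCoins (dev : Device κ) where
  /-- the random bytes with which the device is filled first -/
  noise : Disk dev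
  salt : Word κ
  /-- the random value that stands for the master key of the volume preceding the first one -/
  vmkInit : Word κ
  /-- the shuffled array of physical slices -/
  prm : Equiv.Perm (Fin dev.numSlices)
  vol : Fin dev.maxVols → VolCoins dev

/-- The fresh IVs with which the position maps are encrypted when the volumes are closed. -/
abbrev CloseCoins (dev : Device κ) : Type := Fin dev.maxVols → Fin dev.numSlices → Word κ

set_option synthInstance.maxSize 1000 in
set_option synthInstance.maxHeartbeats 200000 in
noncomputable instance (dev : Device κ) : Fintype (Oracles dev) :=
  Fintype.ofInjective (fun x => (x.kdf, x.cipher, x.ae)) fun x y h => by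
    cases x; cases y; simpa using h

set_option synthInstance.maxSize 1000 in
set_option synthInstance.maxHeartbeats 200000 in
noncomputable instance (dev : Device κ) : Fintype (Disk dev) :=
  Fintype.ofInjective (fun x => (x.salt, x.cell, x.dmbRest, x.vmb, x.posMap, x.data))
    fun x y h => by cases x; cases y; simpa using h

noncomputable instance (dev : Device κ) : Fintype (VolCoins dev) :=
  Fintype.ofInjective (fun x => (x.vmk, x.vek, x.cellIV, x.vmbIV, x.vmbFill, x.mapIV))
    fun x y h => by cases x; cases y; simpa using h

noncomputable instance (dev : Device κ) : Fintype (SetupCoins dev) :=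
  Fintype.ofInjective (fun x => (x.noise, x.salt, x.vmkInit, x.prm, x.vol))
    fun x y h => by cases x; cases y; simpa using h

instance (dev : Device κ) : Nonempty (Oracles dev) :=
  ⟨{ kdf := fun _ _ _ => false
     cipher := fun _ _ => Equiv.refl _
     ae := fun _ _ =>
       { toFun := fun x j => if h : (j : ℕ) < κ then x ⟨j, h⟩ else false
         inj' := fun x y hxy => funext fun j => by
          simpa using congrFun hxy (Fin.castLE dev.le_aeLen j) } }⟩

instance (dev : Device κ) : Nonempty (Disk dev) :=
  ⟨⟨default, default, default, default, default, default⟩⟩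

instance (dev : Device κ) : Nonempty (VolCoins dev) :=
  ⟨⟨default, default, default, default, default, default⟩⟩

instance (dev : Device κ) : Nonempty (SetupCoins dev) :=
  ⟨⟨Classical.arbitrary _, default, default, 1, fun _ => Classical.arbitrary _⟩⟩

/-! ### The scheme

Volumes are numbered from `0`. -/

/-- A running instance: the disk together with the state in RAM. -/
structure Inst (dev : Device κ) where
  disk : Disk dev
  /-- the encryption key of every volume, `none` for a volume that does not exist -/
  vek : Fin dev.maxVols → Option (Word κ)
  /-- the position maps, `none` for an unmapped logical slice -/
  posMap : Fin dev.maxVols → Fin dev.numSlices → Option (Fin dev.numSlices)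
  /-- the pre-shuffled array of physical slices -/
  prm : Fin dev.numSlices → Fin dev.numSlices
  /-- the occupation bitfield: `true` for an occupied physical slice -/
  bfld : Fin dev.numSlices → Bool
  /-- the occupation counter, a position in `prm` -/
  octr : ℕ

variable {dev : Device κ}

/-- The encoding of a position map entry as a block. -/
def encodeEntry (κ : ℕ) {m : ℕ} : Option (Fin m) → Word κ
  | none => encodeNat κ 0
  | some ψ => encodeNat κ (ψ + 1)

/-- The position map `pm` encrypted under `key` with one IV for each entry. -/
def encryptMap (O : Oracles dev) (key : Word κ) (iv : Fin dev.numSlices → Word κ)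
    (pm : Fin dev.numSlices → Option (Fin dev.numSlices)) : Fin dev.numSlices → Word κ × Word κ :=
  fun σ => (iv σ, O.cipher key (iv σ) (encodeEntry κ (pm σ)))

/-- The volume master key of the volume preceding volume `i`. -/
def SetupCoins.prevVmk (c : SetupCoins dev) (i : Fin dev.maxVols) : Word κ :=
  if (i : ℕ) = 0 then c.vmkInit else (c.vol ⟨i - 1, (Nat.sub_le _ _).trans_lt i.isLt⟩).vmk

/-- The plaintext of the VMB of volume `i`: the volume encryption key, the master key of the previous
volume, the number of slices, and random filler. -/
def SetupCoins.vmbPlain (c : SetupCoins dev) (i : Fin dev.maxVols) : Fin dev.vmbLen → Word κ :=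
  Fin.cons (c.vol i).vek (Fin.cons (c.prevVmk i)
    (Fin.cons (encodeNat κ dev.numSlices) (c.vol i).vmbFill))

/-- The disk after initialisation with the passwords `pws`: random bytes everywhere, except for the
salt and the headers of the volumes that are created. -/
def initDisk (O : Oracles dev) (c : SetupCoins dev) (pws : List (Word κ)) : Disk dev where
  salt := c.salt
  cell := fun i =>
    match pws[(i : ℕ)]? with
    | some pw => ((c.vol i).cellIV, O.ae (O.kdf pw c.salt) (c.vol i).cellIV (c.vol i).vmk)
    | none => c.noise.cell i
  dmbRest := c.noise.dmbRest
  vmb := fun i =>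
    match pws[(i : ℕ)]? with
    | some _ => fun j => ((c.vol i).vmbIV j,
        O.cipher (c.vol i).vmk ((c.vol i).vmbIV j) (c.vmbPlain i j))
    | none => c.noise.vmb i
  posMap := fun i =>
    match pws[(i : ℕ)]? with
    | some _ => encryptMap O (c.vol i).vek (c.vol i).mapIV fun _ => none
    | none => c.noise.posMap i
  data := c.noise.data

/-- Initialises the disk with one volume for each password, and opens all of them. -/
def setup (O : Oracles dev) (c : SetupCoins dev) (pws : List (Word κ)) : Inst dev where
  disk := initDisk O c pws
  vek := fun i => if (i : ℕ) < pws.length then some (c.vol i).vek else none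
  posMap := fun _ _ => none
  prm := c.prm
  bfld := fun _ => false
  octr := 0

/-- Reads block `B` of volume `i`; an unmapped slice reads as zero. -/
def read (O : Oracles dev) (s : Inst dev) (i : Fin dev.maxVols) (B : dev.Addr) : Word κ :=
  match s.vek i, s.posMap i B.divNat with
  | some key, some ψ => (O.cipher key (s.disk.data ψ B.modNat).1).symm (s.disk.data ψ B.modNat).2
  | _, _ => fun _ => false

/-- Maps the logical slice `σ` of volume `i` to the next free physical slice of the shuffled array;
fails if no physical slice is free. -/
def newSlice (s : Inst dev) (i : Fin dev.maxVols) (σ : Fin dev.numSlices) :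
    Option (Fin dev.numSlices × Inst dev) :=
  ((List.finRange dev.numSlices).find? fun (k : Fin dev.numSlices) => decide (s.octr ≤ (k : ℕ)) && !s.bfld (s.prm k)).map
    fun k => (s.prm k,
      { s with
        octr := k
        bfld := Function.update s.bfld (s.prm k) true
        posMap := Function.update s.posMap i (Function.update (s.posMap i) σ (some (s.prm k))) })

/-- Stores the pair of an IV and a ciphertext at offset `j` of the physical slice `ψ`. -/
def Inst.store (s : Inst dev) (ψ : Fin dev.numSlices) (j : Fin dev.sliceLen)
    (x : Word κ × Word κ) : Inst dev :=
  { s with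
    disk := { s.disk with
      data := Function.update s.disk.data ψ (Function.update (s.disk.data ψ) j x) } }

/-- Writes `d` to block `B` of volume `i` with the fresh IV `iv`; `none` is the error that occurs when
a new slice is needed but none is free (or when there is no volume `i`). -/
def write (O : Oracles dev) (s : Inst dev) (i : Fin dev.maxVols) (B : dev.Addr) (d iv : Word κ) :
    Option (Inst dev) :=
  (s.vek i).bind fun key =>
    (match s.posMap i B.divNat with
      | some ψ => some (ψ, s)
      | none => newSlice s i B.divNat).map
    fun (p : Fin dev.numSlices × Inst dev) => p.2.store p.1 B.modNat (iv, O.cipher key iv d)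

/-- Closes all the volumes: the position maps are written to the disk, encrypted with fresh IVs.
The result is the disk as it is left behind. -/
def close (O : Oracles dev) (s : Inst dev) (c : CloseCoins dev) : Disk dev :=
  { s.disk with
    posMap := fun i =>
      match s.vek i with
      | some key => encryptMap O key (c i) (s.posMap i)
      | none => s.disk.posMap i }

/-! ### Access patterns -/

/-- An access: a read, a write, or the empty access. -/
inductive Access (dev : Device κ) where
  | read (i : Fin dev.maxVols) (B : dev.Addr)
  | write (i : Fin dev.maxVols) (B : dev.Addr) (d : Word κ)
  | empty

/-- The access, if it is not empty, concerns one of the first `k` volumes. -/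
def Access.Targets (k : ℕ) : Access dev → Prop
  | .read i _ => (i : ℕ) < k
  | .write i _ _ => (i : ℕ) < k
  | .empty => True

/-- The effect of one access; a write that fails has no effect. -/
def step (O : Oracles dev) (s : Inst dev) (iv : Word κ) : Access dev → Inst dev
  | .write i B d => (write O s i B d iv).getD s
  | .read _ _ => s
  | .empty => s

/-- Executes an access pattern; `iv` holds one fresh IV for each access (reads leave it unused). -/
def exec (O : Oracles dev) :
    Inst dev → (ops : List (Access dev)) → (Fin ops.length → Word κ) → Inst dev
  | s, [], _ => s
  | s, a :: ops, iv => exec O (step O s (iv 0) a) ops (Fin.tail iv)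

/-- What an access pattern does to the logical volumes: the logical slices in use, and the value last
written to every block (`none` for a block that has not been written). -/
structure Logical (dev : Device κ) where
  mapped : Finset (Fin dev.maxVols × Fin dev.numSlices)
  content : Fin dev.maxVols → dev.Addr → Option (Word κ)

/-- A write is carried out unless it falls in a new logical slice and all of the physical slices are
already in use. -/
def Logical.step (s : Logical dev) : Access dev → Logical dev
  | .write i B d =>
    if (i, B.divNat) ∈ s.mapped ∨ s.mapped.card < dev.numSlices then
      { mapped := insert (i, B.divNat) s.mapped
        content := Function.update s.content i (Function.update (s.content i) B (some d)) }
    else s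
  | .read _ _ => s
  | .empty => s

/-- The logical outcome of an access pattern on new volumes. -/
def logical (ops : List (Access dev)) : Logical dev :=
  ops.foldl Logical.step { mapped := ∅, content := fun _ _ => none }

/-! ### The single-snapshot game -/

/-- What the adversary chooses before the snapshot: `ℓ = pws.length + 1`, the passwords of the
`ℓ - 1` decoy volumes, and two access patterns subject to the constraints. -/
structure Challenge (dev : Device κ) where
  pws : List (Word κ)
  /-- the access pattern for the device with the hidden volume -/
  ops₀ : List (Access dev)
  /-- the access pattern for the device without it -/
  ops₁ : List (Access dev)
  length_lt : pws.length + 1 ≤ dev.maxVols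
  targets₀ : ∀ a ∈ ops₀, a.Targets (pws.length + 1)
  targets₁ : ∀ a ∈ ops₁, a.Targets pws.length
  /-- the decoy volumes have the same logical contents in the end (zero where nothing was written) -/
  same_content : ∀ i : Fin dev.maxVols, (i : ℕ) < pws.length → ∀ B,
    ((logical ops₀).content i B).getD (fun _ => false) =
      ((logical ops₁).content i B).getD (fun _ => false)
  /-- the same blocks of the decoy volumes have been written -/
  same_written : ∀ i : Fin dev.maxVols, (i : ℕ) < pws.length →
    {B | ((logical ops₀).content i B).isSome} = {B | ((logical ops₁).content i B).isSome}

/-- An adversary makes a choice and then outputs a bit when it is given the disk snapshot, with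
access to the oracles before and after. -/
abbrev Adversary (dev : Device κ) : Type :=
  OracleComp dev (Challenge dev × (Disk dev → OracleComp dev Bool))

/-- The adversary makes at most `n` queries altogether. -/
def Adversary.MakesAtMost (A : Adversary dev) (n : ℕ) : Prop :=
  OracleComp.Within (fun r m => ∀ D, (r.2 D).Within (fun _ _ => True) m) A n

/-- The passwords of the volumes that are created in the case `b`, where `b = false` stands for `0`
(the hidden volume, with password `P`, is present) and `b = true` for `1` (it is absent). -/
def Challenge.passwords (ch : Challenge dev) (P : Word κ) : Bool → List (Word κ)
  | false => ch.pws ++ [P]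
  | true => ch.pws

/-- The access pattern that is executed in the case `b`. -/
def Challenge.ops (ch : Challenge dev) : Bool → List (Access dev)
  | false => ch.ops₀
  | true => ch.ops₁

/-- The distribution of the disk snapshot in the case `b`. -/
noncomputable def snapshot (O : Oracles dev) (ch : Challenge dev) (b : Bool) : PMF (Disk dev) := do
  let P ← PMF.uniformOfFintype (Word κ)
  let c ← PMF.uniformOfFintype (SetupCoins dev)
  let iv ← PMF.uniformOfFintype (Fin (ch.ops b).length → Word κ)
  let c' ← PMF.uniformOfFintype (CloseCoins dev)
  return close O (exec O (setup O c (ch.passwords P b)) (ch.ops b) iv) c'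

/-- The output of the adversary in the case `b`. -/
noncomputable def game (A : Adversary dev) (b : Bool) : PMF Bool := do
  let O ← PMF.uniformOfFintype (Oracles dev)
  let r ← A.run O
  let D ← snapshot O r.1 b
  (r.2 D).run O

/-- The distinguishing advantage. -/
noncomputable def advantage (A : Adversary dev) : ℝ :=
  |(game A false true).toReal - (game A true true).toReal|

/-! ### Security and correctness -/

/-- Correctness: a read returns what the most recent successful write to the same block of the same
volume has written, with certainty. -/
def IsCorrect (dev : Device κ) : Prop :=
  ∀ (O : Oracles dev) (c : SetupCoins dev) (pws : List (Word κ)), pws.length ≤ dev.maxVols →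
  ∀ (ops : List (Access dev)) (ivs : Fin ops.length → Word κ)
    (i : Fin dev.maxVols) (B : dev.Addr) (d iv : Word κ) (s : Inst dev),
    write O (exec O (setup O c pws) ops ivs) i B d iv = some s →
  ∀ (ops' : List (Access dev)) (ivs' : Fin ops'.length → Word κ),
    (∀ d', Access.write i B d' ∉ ops') →
    read O (exec O s ops' ivs') i B = d

/-- `f` is bounded by a polynomial. -/
def PolyBounded (f : ℕ → ℕ) : Prop := ∃ p : Polynomial ℕ, ∀ κ, f κ ≤ p.eval κ

/-- `f` is negligible: `f κ * κ ^ c` tends to `0` for every `c`. -/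
def Negligible (f : ℕ → ℝ) : Prop :=
  Asymptotics.SuperpolynomialDecay Filter.atTop (fun κ : ℕ => (κ : ℝ)) f

/-- Single-snapshot security of the scheme on a family of devices: the advantage of every family of
adversaries with polynomially many queries is negligible. -/
def SingleSnapshotSecure (dev : (κ : ℕ) → Device κ) : Prop :=
  ∀ (A : (κ : ℕ) → Adversary (dev κ)) (q : ℕ → ℕ), PolyBounded q →
    (∀ κ, (A κ).MakesAtMost (q κ)) → Negligible fun κ => advantage (A κ)

end Shufflecake

namespace Shufflecake

open Finset
open scoped BigOperators

variable {κ : ℕ} {dev : Device κ}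

/-! Correctness and security both rest on a normal form for the running system. Only the last IV
written to a data block survives, so the fresh IV of a write may be treated as if it had been lying
at that place in the initial noise. After any accesses the state is thus `inst O c pws L`, a
function of coins `c` and of a `Plan` `L` that records the contents and the order of allocation
(`write_inst`). Reads in this form give correctness. On average over the coins, the substitution of
IVs is invisible (`expect_exec`), and so is the exchange of header IVs with those of the noise
(`close_inst`). Hence the snapshot is distributed as `snap`: noise in which every block with a label
(key, plaintext) has its ciphertext half replaced by the value of the cipher, and likewise for the
DMB cells.

The constraints on a challenge force the decoy volumes to have the same written contents and the
same mapped slices in both cases. Only the order of allocation can differ, and the uniform shuffle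
absorbs a permutation that aligns the two orders. After that the labels differ only in blocks of the
hidden volume, which are noise in the case without it (`Duel.lab_cases`).

The cases are then matched world by world, a world being the oracles, the coins and the secrets of
the hidden volume. Starting from a world without the hidden volume, `Duel.bridge` exchanges the
value of the KDF at the secret password with an independent key, and exchanges the noise in the
hidden places with the ciphertexts that the oracles would give there. The disk with the hidden
volume in the new world equals the disk without it in the old one (`Duel.disk₀_bridge`), and the
oracles differ only at secret passwords and keys (`Duel.answer_bridge`). The map is injective when
the block IVs are distinct, so it preserves uniform weight.

Consequently the mass `goodMass A β` of good worlds and runs that avoid secret queries bounds the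
probability of output `β` from below in both cases. Both outputs sum to `1` in either case, so the
advantage is at most `1 - (goodMass A true + goodMass A false)`. This defect is estimated in the
case without the hidden volume, where the view is independent of the secrets: `2 / 2 ^ κ` for each
query, plus the probability of a guessed decoy password or key and of an IV collision
(`one_sub_goodMass_le`). -/

open Classical in
/-- The indicator of a proposition. -/
noncomputable def ind (p : Prop) : ℝ := if p then 1 else 0

theorem ind_pos {p : Prop} (h : p) : ind p = 1 := if_pos h

theorem ind_neg {p : Prop} (h : ¬ p) : ind p = 0 := if_neg h

theorem ind_nonneg (p : Prop) : 0 ≤ ind p := by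
  unfold ind
  split_ifs <;> norm_num

theorem ind_le_one (p : Prop) : ind p ≤ 1 := by
  unfold ind
  split_ifs <;> norm_num

theorem ind_or_le (p q : Prop) : ind (p ∨ q) ≤ ind p + ind q := by
  by_cases hp : p <;> by_cases hq : q <;> simp [ind, hp, hq]

/-! ### Averages over finite types -/

section Expectation

variable {X Y : Type*} [Fintype X] [Fintype Y]

theorem toReal_uniform_bind_apply [Nonempty X] {Z : Type*} (f : X → PMF Z) (z : Z) :
    (((PMF.uniformOfFintype X).bind f) z).toReal = 𝔼 x, (f x z).toReal := by
  rw [PMF.bind_apply, tsum_fintype,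
    ENNReal.toReal_sum fun x _ => ENNReal.mul_ne_top (PMF.apply_ne_top _ _) (PMF.apply_ne_top _ _),
    Fintype.expect_eq_sum_div_card, Finset.sum_div]
  refine Finset.sum_congr rfl fun x _ => ?_
  rw [ENNReal.toReal_mul, PMF.uniformOfFintype_apply, ENNReal.toReal_inv, ENNReal.toReal_natCast,
    div_eq_inv_mul]

theorem expect_comp_equiv (e : X ≃ Y) (f : Y → ℝ) : 𝔼 x, f (e x) = 𝔼 y, f y :=
  Fintype.expect_equiv e _ _ fun _ => rfl

theorem expect_comp_involutive {e : X → X} (he : Function.Involutive e) (f : X → ℝ) :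
    𝔼 x, f (e x) = 𝔼 x, f x :=
  expect_comp_equiv he.toPerm f

theorem expect_prod (f : X × Y → ℝ) : 𝔼 p, f p = 𝔼 x, 𝔼 y, f (x, y) := by
  rw [← Finset.univ_product_univ, Finset.expect_product]

theorem expect_swap (f : X → Y → ℝ) : 𝔼 x, 𝔼 y, f x y = 𝔼 y, 𝔼 x, f x y :=
  Finset.expect_comm _ _ _

/-- Exchanging a part of a sample with independent fresh randomness does not change expectations. -/
theorem expect_resample [Nonempty Y] (upd : X → Y → X) (get : X → Y)
    (h₁ : ∀ x y, upd (upd x y) (get x) = x) (h₂ : ∀ x y, get (upd x y) = y) (f : X → ℝ) :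
    𝔼 x, 𝔼 y, f (upd x y) = 𝔼 x, f x := by
  -- The exchange of the stored part with the fresh one is an involution of `X × Y`, hence preserves
  -- the average.
  have h := expect_comp_involutive (X := X × Y) (e := fun p => (upd p.1 p.2, get p.1))
    (fun p => by simp [h₁, h₂]) fun p => f p.1
  rw [expect_prod, expect_prod] at h
  simpa using h

theorem expect_mono {f g : X → ℝ} (h : ∀ x, f x ≤ g x) : 𝔼 x, f x ≤ 𝔼 x, g x :=
  Finset.expect_le_expect fun x _ => h x

theorem expect_le_of_forall_le [Nonempty X] {f : X → ℝ} {a : ℝ} (h : ∀ x, f x ≤ a) :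
    𝔼 x, f x ≤ a :=
  (expect_mono h).trans_eq (Fintype.expect_const a)

theorem expect_ind_eq [Nonempty X] (a : X) : 𝔼 x, ind (x = a) = 1 / Fintype.card X := by
  classical
  rw [Fintype.expect_eq_sum_div_card]
  simp [ind]

end Expectation

theorem card_word (n : ℕ) : (Fintype.card (Word n) : ℝ) = 2 ^ n := by
  simp

noncomputable instance (q : Query dev) : Fintype q.Answer := by
  cases q <;> exact inferInstance

/-! ### Runs restricted to harmless queries -/

namespace OracleComp

variable {α : Type}

open Classical in
/-- The expectation of `g` over the results of those runs of a computation that do not make any query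
in `Bad`. -/
noncomputable def ev (O : Oracles dev) (Bad : Query dev → Prop) :
    OracleComp dev α → (α → ℝ) → ℝ
  | .pure a, g => g a
  | .coin k, g => 𝔼 b, (k b).ev O Bad g
  | .query q k, g => if Bad q then 0 else (k (O.answer q)).ev O Bad g

theorem toReal_run_bind_apply (O : Oracles dev) {Z : Type} (c : OracleComp dev α) (f : α → PMF Z)
    (z : Z) :
    (((c.run O).bind f) z).toReal = c.ev O (fun _ => False) fun a => (f a z).toReal := by
  induction c with
  | pure a => simp [run, ev]
  | coin k ih =>
    rw [run, PMF.bind_bind, toReal_uniform_bind_apply, ev]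
    exact Finset.expect_congr rfl fun b _ => ih b
  | query q k ih => simpa [run, ev] using ih (O.answer q)

theorem toReal_run_apply (O : Oracles dev) (c : OracleComp dev Bool) (b : Bool) :
    (c.run O b).toReal = c.ev O (fun _ => False) fun a => ind (a = b) := by
  have h := toReal_run_bind_apply O c PMF.pure b
  rw [PMF.bind_pure] at h
  rw [h]
  congr 1
  funext a
  rw [PMF.pure_apply]
  by_cases hab : a = b
  · simp [hab, ind]
  · rw [ind_neg hab, if_neg (Ne.symm hab), ENNReal.toReal_zero]

variable {O O' : Oracles dev} {Bad Bad' : Query dev → Prop}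

theorem ev_mono (c : OracleComp dev α) {g g' : α → ℝ} (h : ∀ a, g a ≤ g' a) :
    c.ev O Bad g ≤ c.ev O Bad g' := by
  induction c with
  | pure a => exact h a
  | coin k ih => exact expect_mono fun b => ih b
  | query q k ih =>
    simp only [ev]
    split_ifs
    · rfl
    · exact ih _

theorem ev_zero (c : OracleComp dev α) : c.ev O Bad (fun _ => 0) = 0 := by
  induction c with
  | pure a => rfl
  | coin k ih => simp [ev, ih]
  | query q k ih => simp [ev, ih]

theorem ev_nonneg (c : OracleComp dev α) {g : α → ℝ} (h : ∀ a, 0 ≤ g a) : 0 ≤ c.ev O Bad g :=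
  (ev_zero c).symm.trans_le (ev_mono c h)

/-- Lifting the restriction only adds runs, and these contribute nonnegative amounts of `g'`; `g`
itself may have any sign. -/
theorem ev_le_ev_unrestricted (c : OracleComp dev α) {g g' : α → ℝ} (h₀ : ∀ a, 0 ≤ g' a)
    (h : ∀ a, g a ≤ g' a) : c.ev O Bad g ≤ c.ev O (fun _ => False) g' := by
  induction c with
  | pure a => exact h a
  | coin k ih => exact expect_mono fun b => ih b
  | query q k ih =>
    simp only [ev, if_false]
    split_ifs
    · exact ev_nonneg _ h₀
    · exact ih _

theorem ev_one (c : OracleComp dev α) : c.ev O (fun _ => False) (fun _ => 1) = 1 := by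
  induction c with
  | pure a => rfl
  | coin k ih => simp [ev, ih]
  | query q k ih => simp [ev, ih]

theorem ev_le_one (c : OracleComp dev α) {g : α → ℝ} (h : ∀ a, g a ≤ 1) : c.ev O Bad g ≤ 1 :=
  (ev_le_ev_unrestricted c (fun _ => zero_le_one) h).trans_eq (ev_one c)

theorem ev_expect {X : Type*} [Fintype X] (c : OracleComp dev α) (g : X → α → ℝ) :
    c.ev O Bad (fun a => 𝔼 x, g x a) = 𝔼 x, c.ev O Bad (g x) := by
  induction c with
  | pure a => rfl
  | coin k ih =>
    simp only [ev, ih]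
    exact expect_swap _
  | query q k ih =>
    simp only [ev]
    split_ifs
    · simp
    · exact ih _

theorem ev_add (c : OracleComp dev α) (g g' : α → ℝ) :
    c.ev O Bad (fun a => g a + g' a) = c.ev O Bad g + c.ev O Bad g' := by
  induction c with
  | pure a => rfl
  | coin k ih =>
    simp only [ev, ih]
    exact Finset.expect_add_distrib _ _ _
  | query q k ih =>
    simp only [ev]
    split_ifs
    · simp
    · exact ih _

theorem ev_congr_oracles (hB : ∀ q, Bad' q ↔ Bad q) (hO : ∀ q, ¬ Bad q → O'.answer q = O.answer q)
    (c : OracleComp dev α) (g : α → ℝ) : c.ev O' Bad' g = c.ev O Bad g := by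
  induction c with
  | pure a => rfl
  | coin k ih => simp only [ev, ih]
  | query q k ih =>
    by_cases h : Bad q
    · simp [ev, hB q, h]
    · simp [ev, hB q, h, ih, hO q h]

/-- Runs that avoid the queries on which two worlds may differ are as likely in the one as in the
other, for a correspondence between the worlds that may depend on the result of the run. -/
theorem sum_ev_le_sum_ev {X : Type*} [Fintype X] {O₁ O₀ : X → Oracles dev}
    {B₁ B₀ : X → Query dev → Prop} {Φ : α → X → X} {G : α → X → Prop}
    (hinj : ∀ r, Set.InjOn (Φ r) {x | G r x})
    (hB : ∀ r x, G r x → ∀ q, B₀ (Φ r x) q ↔ B₁ x q)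
    (hO : ∀ r x, G r x → ∀ q, ¬ B₁ x q → (O₀ (Φ r x)).answer q = (O₁ x).answer q)
    {F₁ F₀ : X → α → ℝ} (hF₀ : ∀ x r, 0 ≤ F₀ x r) (hG : ∀ x r, ¬ G r x → F₁ x r = 0)
    (hF : ∀ x r, G r x → F₁ x r ≤ F₀ (Φ r x) r) (c : OracleComp dev α) :
    ∑ x, c.ev (O₁ x) (B₁ x) (F₁ x) ≤ ∑ x, c.ev (O₀ x) (B₀ x) (F₀ x) := by
  classical
  -- The correspondence `Φ r` is known only once the run has ended with `r`, so worlds cannot be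
  -- paired during the run. Instead `W₁` and `W₀` collect the worlds consistent with the transcript
  -- so far, and they are compared along every `Φ r`; pairing takes place at the leaves.
  suffices h : ∀ W₁ W₀ : X → Prop, (∀ r x, G r x → (W₀ (Φ r x) ↔ W₁ x)) →
      ∑ x, (if W₁ x then c.ev (O₁ x) (B₁ x) (F₁ x) else 0) ≤
        ∑ x, (if W₀ x then c.ev (O₀ x) (B₀ x) (F₀ x) else 0) by
    simpa using h (fun _ => True) (fun _ => True) fun _ _ _ => Iff.rfl
  induction c with
  | pure r =>
    intro W₁ W₀ hW
    simp only [ev]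
    calc ∑ x, (if W₁ x then F₁ x r else 0)
        = ∑ x with G r x, (if W₁ x then F₁ x r else 0) := by
          rw [Finset.sum_filter]
          refine Finset.sum_congr rfl fun x _ => ?_
          by_cases h : G r x <;> simp [h, hG]
      _ ≤ ∑ x with G r x, (if W₀ (Φ r x) then F₀ (Φ r x) r else 0) := by
          refine Finset.sum_le_sum fun x hx => ?_
          have hx' : G r x := (Finset.mem_filter.1 hx).2
          simp only [hW r x hx']
          split_ifs
          · exact hF x r hx'
          · rfl
      _ = ∑ x ∈ ({x | G r x} : Finset X).image (Φ r), (if W₀ x then F₀ x r else 0) := by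
          -- Injectivity of `Φ r` on the good worlds prevents a world of the target from being
          -- counted twice. Surjectivity is not needed, as the remaining terms are nonnegative.
          rw [Finset.sum_image fun x hx y hy h => hinj r (by simpa using hx) (by simpa using hy) h]
      _ ≤ _ := by
          refine Finset.sum_le_sum_of_subset_of_nonneg (Finset.subset_univ _) fun x _ _ => ?_
          split_ifs
          · exact hF₀ x r
          · rfl
  | coin k ih =>
    intro W₁ W₀ hW
    have key : ∀ (W : X → Prop) (g : Bool → X → ℝ),
        ∑ x, (if W x then 𝔼 b, g b x else 0) = 𝔼 b, ∑ x, (if W x then g b x else 0) := by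
      intro W g
      rw [Finset.expect_sum_comm]
      refine Finset.sum_congr rfl fun x _ => ?_
      split_ifs <;> simp
    simp only [ev]
    rw [key W₁ fun b x => (k b).ev (O₁ x) (B₁ x) (F₁ x),
      key W₀ fun b x => (k b).ev (O₀ x) (B₀ x) (F₀ x)]
    exact expect_mono fun b => ih b W₁ W₀ hW
  | query q k ih =>
    intro W₁ W₀ hW
    -- Splitting the worlds by the answer `a` makes the continuation `k a` the same for all of them,
    -- so that the induction hypothesis applies.
    have key : ∀ (W : X → Prop) (O : X → Oracles dev) (B : X → Query dev → Prop) (F : X → α → ℝ),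
        ∑ x, (if W x then (OracleComp.query q k).ev (O x) (B x) (F x) else 0) =
          ∑ a, ∑ x, (if W x ∧ ¬ B x q ∧ (O x).answer q = a then
            (k a).ev (O x) (B x) (F x) else 0) := by
      intro W O B F
      rw [Finset.sum_comm]
      refine Finset.sum_congr rfl fun x _ => ?_
      simp only [ev]
      by_cases hw : W x <;> by_cases hb : B x q <;> simp [hw, hb]
    rw [key W₁ O₁ B₁ F₁, key W₀ O₀ B₀ F₀]
    refine Finset.sum_le_sum fun a _ => ?_
    have h := ih a (fun x => W₁ x ∧ ¬ B₁ x q ∧ (O₁ x).answer q = a)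
      (fun x => W₀ x ∧ ¬ B₀ x q ∧ (O₀ x).answer q = a) fun r x hx => by
        rw [hW r x hx, hB r x hx]
        by_cases hb : B₁ x q
        · simp [hb]
        · rw [hO r x hx q hb]
    refine le_of_eq_of_le (Finset.sum_congr rfl fun x _ => ?_)
      (h.trans_eq (Finset.sum_congr rfl fun x _ => ?_)) <;> congr

/-- The probability that one of `n` adaptive queries hits a bad set that is sampled independently of
the oracles. -/
theorem expect_one_sub_ev_le {H : Type*} [Fintype H] [Nonempty H] (B : H → Query dev → Prop)
    {ε δ : ℝ}
    (hB : ∀ q, 𝔼 h, ind (B h q) ≤ ε)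
    {post : α → ℕ → Prop} (g : H → α → ℝ) (hg : ∀ h a, g h a ≤ 1)
    (hpost : ∀ a m, post a m → 𝔼 h, (1 - g h a) ≤ m * ε + δ)
    (c : OracleComp dev α) (n : ℕ) (hc : c.Within post n) :
    𝔼 h, (1 - c.ev O (B h) (g h)) ≤ n * ε + δ := by
  classical
  induction c generalizing n with
  | pure a => exact hpost a n hc
  | coin k ih =>
    have : ∀ h, (1 - 𝔼 b, (k b).ev O (B h) (g h)) = 𝔼 b, (1 - (k b).ev O (B h) (g h)) := by
      intro h
      rw [Finset.expect_sub_distrib, Fintype.expect_const]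
    simp only [ev, this]
    rw [expect_swap]
    exact expect_le_of_forall_le fun b => ih b n (hc b)
  | query q k ih =>
    cases n with
    | zero => exact hc.elim
    | succ n =>
      calc 𝔼 h, (1 - (OracleComp.query q k).ev O (B h) (g h))
          ≤ 𝔼 h, (ind (B h q) + (1 - (k (O.answer q)).ev O (B h) (g h))) := by
            -- A union bound: either the first query is bad, or the loss comes from the
            -- continuation. The answer does not depend on `h`, so one continuation serves all `h`.
            refine expect_mono fun h => ?_
            have h₁ : (k (O.answer q)).ev O (B h) (g h) ≤ 1 := ev_le_one _ (hg h)
            by_cases hb : B h q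
            · simp only [ev, if_pos hb, ind_pos hb]
              linarith
            · simp [ev, hb, ind]
        _ ≤ ε + (n * ε + δ) := by
            rw [Finset.expect_add_distrib]
            exact add_le_add (hB q) (ih _ n (hc _))
        _ = _ := by push_cast; ring

end OracleComp

/-! ### Encrypted blocks and the resampling of their IVs -/

/-- The positions of the cipher-encrypted blocks on the disk: volume master blocks, position maps and
data section. -/
abbrev Blk (dev : Device κ) : Type :=
  (Fin dev.maxVols × Fin dev.vmbLen) ⊕ (Fin dev.maxVols × Fin dev.numSlices) ⊕
    (Fin dev.numSlices × Fin dev.sliceLen)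

/-- The position of a block of the data section. -/
abbrev dataBlk (ψ : Fin dev.numSlices) (j : Fin dev.sliceLen) : Blk dev := .inr (.inr (ψ, j))

theorem card_blk (dev : Device κ) : Fintype.card (Blk dev) = dev.encBlocks := by
  simp only [Fintype.card_sum, Fintype.card_prod, Fintype.card_fin, Device.encBlocks]
  ring

/-- The cipher-encrypted blocks of a disk. -/
def Disk.blk (D : Disk dev) : Blk dev → Word κ × Word κ
  | .inl p => D.vmb p.1 p.2
  | .inr (.inl p) => D.posMap p.1 p.2
  | .inr (.inr p) => D.data p.1 p.2

/-- The disk `D` with other cipher-encrypted blocks. -/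
def Disk.withBlk (D : Disk dev) (f : Blk dev → Word κ × Word κ) : Disk dev :=
  { D with
    vmb := fun i j => f (.inl (i, j))
    posMap := fun i σ => f (.inr (.inl (i, σ)))
    data := fun ψ j => f (dataBlk ψ j) }

@[simp] theorem Disk.blk_withBlk (D : Disk dev) (f : Blk dev → Word κ × Word κ) :
    (D.withBlk f).blk = f := by
  funext b
  rcases b with _ | _ | _ <;> rfl

@[simp] theorem Disk.withBlk_blk (D : Disk dev) : D.withBlk D.blk = D := rfl

@[simp] theorem Disk.withBlk_withBlk (D : Disk dev) (f g : Blk dev → Word κ × Word κ) :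
    (D.withBlk f).withBlk g = D.withBlk g := rfl

/-- Replaces the IV of one block of the initial noise. -/
def SetupCoins.setIV (c : SetupCoins dev) (b : Blk dev) (v : Word κ) : SetupCoins dev :=
  { c with noise := c.noise.withBlk (Function.update c.noise.blk b (v, (c.noise.blk b).2)) }

theorem expect_setIV (b : Blk dev) (f : SetupCoins dev → ℝ) :
    𝔼 c : SetupCoins dev, 𝔼 v : Word κ, f (c.setIV b v) = 𝔼 c, f c := by
  have h := expect_resample (fun (c : SetupCoins dev) (v : Word κ) => c.setIV b v)
    (fun c => (c.noise.blk b).1)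
    (fun c v => by simp [SetupCoins.setIV]) (fun c v => by simp [SetupCoins.setIV]) f
  rw [← h]

/-- Like `expect_setIV`, for a position in the data section that is given by its rank in the shuffled
array. -/
theorem expect_setIV_data (k : Fin dev.numSlices) (j : Fin dev.sliceLen) (f : SetupCoins dev → ℝ) :
    𝔼 c : SetupCoins dev, 𝔼 v : Word κ, f (c.setIV (dataBlk (c.prm k) j) v) = 𝔼 c, f c := by
  -- The place depends on the coins only through `prm`, which `setIV` leaves alone; hence the same
  -- place is found again after the update.
  have h := expect_resample (fun (c : SetupCoins dev) (v : Word κ) => c.setIV (dataBlk (c.prm k) j) v)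
    (fun c => (c.noise.blk (dataBlk (c.prm k) j)).1)
    (fun c v => by simp [SetupCoins.setIV]) (fun c v => by simp [SetupCoins.setIV]) f
  rw [← h]

/-! ### Plans: the logical effect of an access pattern, with the order of allocation -/

/-- The logical slices in use, in the order in which they have been mapped, and the value last written
to every block. -/
structure Plan (dev : Device κ) where
  ord : List (Fin dev.maxVols × Fin dev.numSlices)
  content : Fin dev.maxVols → dev.Addr → Option (Word κ)

namespace Plan

def empty : Plan dev := ⟨[], fun _ _ => none⟩

def toLogical (L : Plan dev) : Logical dev := ⟨L.ord.toFinset, L.content⟩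

structure Valid (L : Plan dev) : Prop where
  nodup : L.ord.Nodup
  length_le : L.ord.length ≤ dev.numSlices
  mem_of_content : ∀ i B, (L.content i B).isSome → (i, B.divNat) ∈ L.ord

/-- There is room for a write. -/
def CanWrite (L : Plan dev) (i : Fin dev.maxVols) (B : dev.Addr) : Prop :=
  (i, B.divNat) ∈ L.ord ∨ L.ord.length < dev.numSlices

instance (L : Plan dev) (i : Fin dev.maxVols) (B : dev.Addr) : Decidable (L.CanWrite i B) :=
  inferInstanceAs (Decidable (_ ∨ _))

/-- The effect of a write that is carried out. -/
def write (L : Plan dev) (i : Fin dev.maxVols) (B : dev.Addr) (d : Word κ) : Plan dev where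
  ord := if (i, B.divNat) ∈ L.ord then L.ord else L.ord ++ [(i, B.divNat)]
  content := Function.update L.content i (Function.update (L.content i) B (some d))

def step (L : Plan dev) : Access dev → Plan dev
  | .write i B d => if L.CanWrite i B then L.write i B d else L
  | .read _ _ => L
  | .empty => L

theorem valid_empty : (empty : Plan dev).Valid :=
  ⟨List.nodup_nil, Nat.zero_le _, fun _ _ h => by simp [empty] at h⟩

variable {L : Plan dev} {i : Fin dev.maxVols} {B : dev.Addr}

theorem content_write (d : Word κ) (i' : Fin dev.maxVols) (B' : dev.Addr) :
    (L.write i B d).content i' B' = if i' = i ∧ B' = B then some d else L.content i' B' := by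
  by_cases hi : i' = i
  · subst hi
    by_cases hB : B' = B <;> simp [write, hB]
  · simp [write, hi]

theorem Valid.write (hL : L.Valid) (h : L.CanWrite i B) (d : Word κ) : (L.write i B d).Valid := by
  refine ⟨?_, ?_, fun i' B' hs => ?_⟩
  · simp only [Plan.write]
    split_ifs with hm
    · exact hL.nodup
    · exact hL.nodup.append (List.nodup_singleton _) (by simpa using hm)
  · simp only [Plan.write]
    split_ifs with hm
    · exact hL.length_le
    · rw [List.length_append]
      exact h.resolve_left hm
  · rw [content_write] at hs
    have hsub : ∀ x, x ∈ L.ord → x ∈ (L.write i B d).ord := by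
      intro x hx
      simp only [Plan.write]
      split_ifs
      · exact hx
      · exact List.mem_append_left _ hx
    split_ifs at hs with he
    · rw [he.1, he.2]
      simp only [Plan.write]
      split_ifs with hm
      · exact hm
      · simp
    · exact hsub _ (hL.mem_of_content i' B' hs)

theorem Valid.step (hL : L.Valid) (a : Access dev) : (L.step a).Valid := by
  cases a with
  | write i B d =>
    simp only [Plan.step]
    split_ifs with h
    · exact hL.write h d
    · exact hL
  | read => exact hL
  | empty => exact hL

theorem Valid.foldl (hL : L.Valid) (ops : List (Access dev)) : (ops.foldl Plan.step L).Valid := by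
  induction ops generalizing L with
  | nil => exact hL
  | cons a ops ih => exact ih (hL.step a)

/-- The list has no duplicates, so its length is the number of slices in use and both models reject
the same writes. -/
theorem toLogical_step (hL : L.Valid) (a : Access dev) :
    (L.step a).toLogical = L.toLogical.step a := by
  cases a with
  | write i B d =>
    by_cases h : L.CanWrite i B
    · have h' : (i, B.divNat) ∈ L.ord.toFinset ∨ L.ord.toFinset.card < dev.numSlices := by
        rwa [List.mem_toFinset, List.toFinset_card_of_nodup hL.nodup]
      refine (congrArg toLogical (if_pos h)).trans (Eq.trans ?_ (if_pos h').symm)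
      simp only [toLogical, Plan.write]
      congr 1
      split_ifs with hm
      · rw [Finset.insert_eq_of_mem (List.mem_toFinset.2 hm)]
      · ext x
        simp [or_comm]
    · have h' : ¬ ((i, B.divNat) ∈ L.ord.toFinset ∨ L.ord.toFinset.card < dev.numSlices) := by
        rwa [List.mem_toFinset, List.toFinset_card_of_nodup hL.nodup]
      exact (congrArg toLogical (if_neg h)).trans (if_neg h').symm
  | read => rfl
  | empty => rfl

theorem toLogical_foldl (hL : L.Valid) (ops : List (Access dev)) :
    (ops.foldl Plan.step L).toLogical = ops.foldl Logical.step L.toLogical := by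
  induction ops generalizing L with
  | nil => rfl
  | cons a ops ih =>
    rw [List.foldl_cons, List.foldl_cons, ih (hL.step a), toLogical_step hL]

/-- All the mapped slices belong to the first `n` volumes. -/
def InFirst (L : Plan dev) (n : ℕ) : Prop := ∀ x ∈ L.ord, (x.1 : ℕ) < n

theorem InFirst.foldl {n : ℕ} (hL : L.InFirst n) (ops : List (Access dev))
    (hops : ∀ a ∈ ops, a.Targets n) : (ops.foldl Plan.step L).InFirst n := by
  induction ops generalizing L with
  | nil => exact hL
  | cons a ops ih =>
    refine ih ?_ fun a' ha' => hops a' (List.mem_cons_of_mem _ ha')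
    have ha := hops a List.mem_cons_self
    cases a with
    | write i B d =>
      simp only [Plan.step]
      split_ifs with h
      · intro x hx
        simp only [Plan.write] at hx
        split_ifs at hx with hm
        · exact hL x hx
        · rcases List.mem_append.1 hx with hx | hx
          · exact hL x hx
          · rw [List.mem_singleton.1 hx]
            exact ha
      · exact hL
    | read => exact hL
    | empty => exact hL

/-- The slices in use are those in which a block has been written. -/
def Tight (L : Plan dev) : Prop :=
  ∀ x ∈ L.ord, ∃ B : dev.Addr, B.divNat = x.2 ∧ (L.content x.1 B).isSome

/-- A slice is mapped only by a write that then succeeds in it, and written blocks never become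
unwritten. -/
theorem Tight.foldl (hL : L.Tight) (ops : List (Access dev)) : (ops.foldl Plan.step L).Tight := by
  induction ops generalizing L with
  | nil => exact hL
  | cons a ops ih =>
    refine ih ?_
    cases a with
    | write i B d =>
      simp only [Plan.step]
      split_ifs with h
      · intro x hx
        by_cases hxe : x = (i, B.divNat)
        · subst hxe
          exact ⟨B, rfl, by rw [content_write]; simp⟩
        · have hx' : x ∈ L.ord := by
            simp only [Plan.write] at hx
            split_ifs at hx with hm
            · exact hx
            · exact (List.mem_append.1 hx).resolve_right fun h => hxe (List.mem_singleton.1 h)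
          obtain ⟨B', hB', hs⟩ := hL x hx'
          refine ⟨B', hB', ?_⟩
          rw [content_write]
          split_ifs
          · rfl
          · exact hs
      · exact hL
    | read => exact hL
    | empty => exact hL

/-- The physical slice of a logical slice. -/
def place (L : Plan dev) (prm : Equiv.Perm (Fin dev.numSlices)) (i : Fin dev.maxVols)
    (σ : Fin dev.numSlices) : Option (Fin dev.numSlices) :=
  -- For a valid plan the bound follows from membership; it is there to form an element of `Fin
  -- dev.numSlices`.
  if h : L.ord.idxOf (i, σ) < dev.numSlices ∧ (i, σ) ∈ L.ord then
    some (prm ⟨L.ord.idxOf (i, σ), h.1⟩) else none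

theorem place_eq_none {prm : Equiv.Perm (Fin dev.numSlices)} {σ : Fin dev.numSlices}
    (h : (i, σ) ∉ L.ord) : L.place prm i σ = none := by
  simp [place, h]

theorem idxOf_eq_of_getElem? {α : Type*} [BEq α] [LawfulBEq α] {l : List α} (hl : l.Nodup) {k : ℕ} {x : α}
    (h : l[k]? = some x) : l.idxOf x = k := by
  obtain ⟨hk, rfl⟩ := List.getElem?_eq_some_iff.1 h
  exact hl.idxOf_getElem k hk

theorem Valid.place_eq_some (hL : L.Valid) (prm : Equiv.Perm (Fin dev.numSlices))
    {x : Fin dev.maxVols × Fin dev.numSlices} {k : Fin dev.numSlices} (h : L.ord[(k : ℕ)]? = some x) :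
    L.place prm x.1 x.2 = some (prm k) := by
  have hk : L.ord.idxOf x = k := idxOf_eq_of_getElem? hL.nodup h
  have hx : x ∈ L.ord := List.mem_of_getElem? h
  rw [place, dif_pos ⟨by rw [hk]; exact k.2, hx⟩]
  congr 2
  exact Fin.ext hk

theorem Valid.exists_getElem? (hL : L.Valid) {x : Fin dev.maxVols × Fin dev.numSlices}
    (hx : x ∈ L.ord) : ∃ k : Fin dev.numSlices, L.ord[(k : ℕ)]? = some x := by
  obtain ⟨k, hk, rfl⟩ := List.getElem_of_mem hx
  exact ⟨⟨k, hk.trans_le hL.length_le⟩, List.getElem?_eq_getElem hk⟩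

/-- The key and the plaintext of a block of the data section, `none` if it still holds noise. -/
def dataLabel (L : Plan dev) (prm : Equiv.Perm (Fin dev.numSlices)) (vek : Fin dev.maxVols → Word κ)
    (ψ : Fin dev.numSlices) (j : Fin dev.sliceLen) : Option (Word κ × Word κ) :=
  L.ord[(prm.symm ψ : ℕ)]?.bind fun x =>
    (L.content x.1 (finProdFinEquiv (x.2, j))).map fun d => (vek x.1, d)

theorem finProd_divNat_modNat (B : dev.Addr) : finProdFinEquiv (B.divNat, B.modNat) = B :=
  finProdFinEquiv.apply_symm_apply B

theorem finProd_eq_iff {σ : Fin dev.numSlices} {j : Fin dev.sliceLen} {B : dev.Addr} :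
    finProdFinEquiv (σ, j) = B ↔ σ = B.divNat ∧ j = B.modNat := by
  rw [← Equiv.eq_symm_apply]
  exact Prod.ext_iff

theorem divNat_finProd (σ : Fin dev.numSlices) (j : Fin dev.sliceLen) :
    Fin.divNat (finProdFinEquiv (σ, j)) = σ :=
  (finProd_eq_iff.1 rfl).1.symm

theorem ord_write_getElem?_ne {d : Word κ} {k k' : ℕ}
    (hL : L.Valid) (hk : (L.write i B d).ord[k]? = some (i, B.divNat)) (hkk : k' ≠ k) :
    (L.write i B d).ord[k']? = L.ord[k']? := by
  simp only [write] at hk ⊢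
  split_ifs at hk ⊢ with hm
  · rfl
  · have hnd : (L.ord ++ [(i, B.divNat)]).Nodup :=
      hL.nodup.append (List.nodup_singleton _) (by simpa using hm)
    have hk' : L.ord.length = k := by
      rw [← idxOf_eq_of_getElem? hnd hk, List.idxOf_append, if_neg hm]
      simp
    rcases lt_or_gt_of_ne hkk with h | h
    · exact List.getElem?_append_left (by omega)
    · rw [List.getElem?_eq_none (by simp; omega), List.getElem?_eq_none (by omega)]

theorem dataLabel_write_same {d : Word κ} {k : Fin dev.numSlices}
    (hk : (L.write i B d).ord[(k : ℕ)]? = some (i, B.divNat)) (prm : Equiv.Perm (Fin dev.numSlices))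
    (vek : Fin dev.maxVols → Word κ) :
    (L.write i B d).dataLabel prm vek (prm k) B.modNat = some (vek i, d) := by
  simp [dataLabel, hk, finProd_divNat_modNat, content_write]

/-- The delicate case is another offset of a newly mapped slice: it is unlabelled before because its
rank is unused, and after because nothing has been written there. A slice of another rank is another
logical slice, as the order has no duplicates. -/
theorem dataLabel_write_ne {d : Word κ} {k : Fin dev.numSlices} (hL : L.Valid) (hc : L.CanWrite i B)
    (hk : (L.write i B d).ord[(k : ℕ)]? = some (i, B.divNat)) (prm : Equiv.Perm (Fin dev.numSlices))
    (vek : Fin dev.maxVols → Word κ) {ψ : Fin dev.numSlices} {j : Fin dev.sliceLen}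
    (h : ψ ≠ prm k ∨ j ≠ B.modNat) :
    (L.write i B d).dataLabel prm vek ψ j = L.dataLabel prm vek ψ j := by
  by_cases hψ : ψ = prm k
  · subst hψ
    have hj : j ≠ B.modNat := by simpa using h
    simp only [dataLabel, Equiv.symm_apply_apply, hk, Option.bind_some]
    rw [content_write, if_neg fun he => hj (finProd_eq_iff.1 he.2).2]
    by_cases hm : (i, B.divNat) ∈ L.ord
    · have : (L.write i B d).ord = L.ord := by simp [write, hm]
      rw [← this, hk, Option.bind_some]
    · have hn : L.content i (finProdFinEquiv (B.divNat, j)) = none := by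
        rw [← Option.not_isSome_iff_eq_none]
        intro hs
        have := hL.mem_of_content _ _ hs
        rw [divNat_finProd] at this
        exact hm this
      have hlen : L.ord[(k : ℕ)]? = none := by
        rw [← Option.not_isSome_iff_eq_none, Option.isSome_iff_exists]
        rintro ⟨x, hx⟩
        have h1 : (L.write i B d).ord[(k : ℕ)]? = some x := by
          simp only [write, hm, if_false]
          rw [List.getElem?_append_left (List.getElem?_eq_some_iff.1 hx).1, hx]
        rw [hk] at h1
        exact hm (Option.some.inj h1 ▸ List.mem_of_getElem? hx)
      rw [hn, hlen]
      rfl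
  · have hkk : ((prm.symm ψ : Fin _) : ℕ) ≠ k := fun he => hψ (by
      rw [← Fin.ext he, Equiv.apply_symm_apply])
    simp only [dataLabel]
    rw [ord_write_getElem?_ne hL hk hkk]
    refine Option.bind_congr fun x hx => ?_
    rw [content_write, if_neg]
    rintro ⟨h1, h2⟩
    refine hkk ?_
    have hx' : (L.write i B d).ord[((prm.symm ψ : Fin _) : ℕ)]? = some (i, B.divNat) := by
      rw [ord_write_getElem?_ne hL hk hkk, hx]
      congr 1
      exact Prod.ext h1 (finProd_eq_iff.1 h2).1
    have hnd := (hL.write hc d).nodup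
    rw [← idxOf_eq_of_getElem? hnd hx', ← idxOf_eq_of_getElem? hnd hk]

theorem Valid.exists_rank (hL : L.Valid) (hc : L.CanWrite i B) (d : Word κ) :
    ∃ k : Fin dev.numSlices, (L.write i B d).ord[(k : ℕ)]? = some (i, B.divNat) := by
  refine (hL.write hc d).exists_getElem? ?_
  simp only [Plan.write]
  split_ifs with hm
  · exact hm
  · simp

end Plan

/-! ### Normal form of a running instance, and correctness -/

/-- The content of a block of the disk: noise `ν` if it has no label, and otherwise the encryption of
the labelled plaintext under the labelled key with the IV of the noise. -/
def overlay (O : Oracles dev) (lab : Option (Word κ × Word κ)) (ν : Word κ × Word κ) :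
    Word κ × Word κ :=
  match lab with
  | some x => (ν.1, O.cipher x.1 ν.1 x.2)
  | none => ν

/-- The running instance that has been set up with the coins `c`, after accesses with the effect `L`,
if every written block has the IV that `c` provides as noise in its place. -/
def inst (O : Oracles dev) (c : SetupCoins dev) (pws : List (Word κ)) (L : Plan dev) : Inst dev where
  disk :=
    { initDisk O c pws with
      data := fun ψ j =>
        overlay O (L.dataLabel c.prm (fun i => (c.vol i).vek) ψ j) (c.noise.data ψ j) }
  vek := fun i => if (i : ℕ) < pws.length then some (c.vol i).vek else none
  posMap := L.place c.prm
  prm := c.prm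
  bfld := fun ψ => decide ((c.prm.symm ψ : ℕ) < L.ord.length)
  -- The scheme leaves the counter at the slice allocated last, not after it; truncated subtraction
  -- gives the initial value `0`.
  octr := L.ord.length - 1

theorem setup_eq_inst (O : Oracles dev) (c : SetupCoins dev) (pws : List (Word κ)) :
    setup O c pws = inst O c pws .empty := by
  simp only [setup, inst, initDisk, Plan.empty, Plan.dataLabel, overlay]
  congr 1
  funext i σ
  exact (Plan.place_eq_none (L := ⟨[], fun _ _ => none⟩) (by simp)).symm

@[simp] theorem SetupCoins.setIV_prm (c : SetupCoins dev) (b : Blk dev) (v : Word κ) :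
    (c.setIV b v).prm = c.prm := rfl

theorem initDisk_setIV_dataBlk (O : Oracles dev) (c : SetupCoins dev) (pws : List (Word κ))
    (ψ : Fin dev.numSlices) (j : Fin dev.sliceLen) (v : Word κ) :
    initDisk O (c.setIV (dataBlk ψ j) v) pws =
      { initDisk O c pws with data := (c.setIV (dataBlk ψ j) v).noise.data } := by
  have h1 : (c.setIV (dataBlk ψ j) v).noise.vmb = c.noise.vmb := by
    funext i j
    simp [SetupCoins.setIV, Disk.withBlk, Disk.blk]
  have h2 : (c.setIV (dataBlk ψ j) v).noise.posMap = c.noise.posMap := by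
    funext i j
    simp [SetupCoins.setIV, Disk.withBlk, Disk.blk]
  simp only [initDisk, h1, h2]
  rfl

theorem setIV_noise_data (c : SetupCoins dev) (ψ : Fin dev.numSlices) (j : Fin dev.sliceLen)
    (v : Word κ) (ψ' : Fin dev.numSlices) (j' : Fin dev.sliceLen) :
    (c.setIV (dataBlk ψ j) v).noise.data ψ' j' =
      if ψ' = ψ ∧ j' = j then (v, (c.noise.data ψ j).2) else c.noise.data ψ' j' := by
  simp only [SetupCoins.setIV, Disk.withBlk, Function.update_apply, Disk.blk]
  by_cases h : ψ' = ψ ∧ j' = j <;> simp [h]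

variable {O : Oracles dev} {c : SetupCoins dev} {pws : List (Word κ)} {L : Plan dev}
  {i : Fin dev.maxVols} {B : dev.Addr} {d : Word κ} {k : Fin dev.numSlices}

theorem store_data_eq (hL : L.Valid) (hc : L.CanWrite i B)
    (hk : (L.write i B d).ord[(k : ℕ)]? = some (i, B.divNat)) (v : Word κ) :
    Function.update (inst O c pws L).disk.data (c.prm k)
        (Function.update ((inst O c pws L).disk.data (c.prm k)) B.modNat
          (v, O.cipher (c.vol i).vek v d)) =
      (inst O (c.setIV (dataBlk (c.prm k) B.modNat) v) pws (L.write i B d)).disk.data := by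
  funext ψ j
  have hv : (fun i => ((c.setIV (dataBlk (c.prm k) B.modNat) v).vol i).vek) =
      fun i => (c.vol i).vek := rfl
  simp only [inst, setIV_noise_data, SetupCoins.setIV_prm, hv]
  by_cases h : ψ = c.prm k ∧ j = B.modNat
  · obtain ⟨rfl, rfl⟩ := h
    simp [Plan.dataLabel_write_same hk, overlay]
  · rw [if_neg h, Plan.dataLabel_write_ne hL hc hk _ _ (by tauto)]
    by_cases hψ : ψ = c.prm k
    · subst hψ
      have hj : j ≠ B.modNat := by simpa using h
      simp [hj]
    · simp [hψ]

/-- The state `s` is abstract so that the lemma covers both a slice that was already mapped and the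
state left by `newSlice`. -/
theorem store_inst (hL : L.Valid) (hc : L.CanWrite i B)
    (hk : (L.write i B d).ord[(k : ℕ)]? = some (i, B.divNat)) (v : Word κ) (s : Inst dev)
    (hdisk : s.disk = (inst O c pws L).disk) (hvek : s.vek = (inst O c pws L).vek)
    (hpos : s.posMap = (L.write i B d).place c.prm) (hprm : s.prm = c.prm)
    (hbfld : s.bfld = fun ψ => decide ((c.prm.symm ψ : ℕ) < (L.write i B d).ord.length))
    (hoctr : s.octr = (L.write i B d).ord.length - 1) :
    s.store (c.prm k) B.modNat (v, O.cipher (c.vol i).vek v d) =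
      inst O (c.setIV (dataBlk (c.prm k) B.modNat) v) pws (L.write i B d) := by
  have h := store_data_eq (O := O) (c := c) (pws := pws) hL hc hk v
  obtain ⟨disk, vek, posMap, prm, bfld, octr⟩ := s
  simp only at hdisk hvek hpos hprm hbfld hoctr
  subst hdisk hvek hpos hprm hbfld hoctr
  simp only [Inst.store, h]
  simp only [inst, initDisk_setIV_dataBlk]
  rfl

/-- The occupied slices are exactly the first `L.ord.length` entries of the shuffled array, so the
search stops at that rank. -/
theorem newSlice_inst (hm : (i, B.divNat) ∉ L.ord) (hL : L.Valid)
    (hk : (k : ℕ) = L.ord.length) (d : Word κ) :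
    newSlice (inst O c pws L) i B.divNat = some (c.prm k,
      { inst O c pws L with
        posMap := (L.write i B d).place c.prm
        bfld := fun ψ => decide ((c.prm.symm ψ : ℕ) < (L.write i B d).ord.length)
        octr := (L.write i B d).ord.length - 1 }) := by
  have hfind : (List.finRange dev.numSlices).find? (fun (k : Fin dev.numSlices) =>
      decide ((inst O c pws L).octr ≤ (k : ℕ)) &&
        !(inst O c pws L).bfld ((inst O c pws L).prm k)) = some k := by
    rw [List.find?_eq_some_iff_getElem]
    refine ⟨?_, k, by simp, by simp, fun j hj => ?_⟩
    · simp [inst, hk]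
    · have : j < L.ord.length := hk ▸ hj
      simp [inst, this]
  have hord : (L.write i B d).ord = L.ord ++ [(i, B.divNat)] := by simp [Plan.write, hm]
  have hlen : (L.write i B d).ord.length = L.ord.length + 1 := by simp [hord]
  have hcan : L.CanWrite i B := Or.inr (hk ▸ k.2)
  have hget : (L.write i B d).ord[(k : ℕ)]? = some (i, B.divNat) := by simp [hord, hk]
  unfold newSlice
  rw [hfind, Option.map_some]
  congr 2
  simp only [inst]
  congr 1
  · funext i' σ'
    by_cases hi : i' = i
    · subst hi
      by_cases hσ : σ' = B.divNat
      · subst hσ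
        simp [(hL.write hcan d).place_eq_some c.prm hget]
      · have hne : (i', B.divNat) ≠ (i', σ') := fun h => hσ (Prod.ext_iff.1 h).2.symm
        simp only [Function.update_self, Function.update_of_ne hσ]
        by_cases hx : (i', σ') ∈ L.ord
        · obtain ⟨k', hk'⟩ := hL.exists_getElem? hx
          have h2 : (L.write i' B d).ord[(k' : ℕ)]? = some (i', σ') := by
            rw [hord, List.getElem?_append_left (List.getElem?_eq_some_iff.1 hk').1, hk']
          exact (hL.place_eq_some c.prm hk').trans ((hL.write hcan d).place_eq_some c.prm h2).symm
        · rw [Plan.place_eq_none hx, Plan.place_eq_none]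
          rw [hord]
          simpa [hx] using hσ
    · simp only [Function.update_of_ne hi]
      by_cases hx : (i', σ') ∈ L.ord
      · obtain ⟨k', hk'⟩ := hL.exists_getElem? hx
        have h2 : (L.write i B d).ord[(k' : ℕ)]? = some (i', σ') := by
          rw [hord, List.getElem?_append_left (List.getElem?_eq_some_iff.1 hk').1, hk']
        exact (hL.place_eq_some c.prm hk').trans ((hL.write hcan d).place_eq_some c.prm h2).symm
      · rw [Plan.place_eq_none hx, Plan.place_eq_none]
        rw [hord]
        simp [hx, hi]
  · funext ψ
    by_cases hψ : ψ = c.prm k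
    · subst hψ
      simp [hlen, hk]
    · have : (c.prm.symm ψ : ℕ) ≠ L.ord.length := fun h => hψ (by
        rw [← hk] at h
        rw [← Fin.ext h, Equiv.apply_symm_apply])
      rw [Function.update_of_ne hψ, hlen]
      simp only [decide_eq_decide]
      omega
  · rw [hlen, hk]
    rfl

theorem newSlice_inst_eq_none (h : ¬ L.ord.length < dev.numSlices) (σ : Fin dev.numSlices) :
    newSlice (inst O c pws L) i σ = none := by
  simp only [newSlice, Option.map_eq_none_iff, List.find?_eq_none]
  intro x _
  have : (x : ℕ) < L.ord.length := by omega
  simp [inst, this]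

/-- The normal form is preserved at the price of changing the coins: the IV `v` of the write is
recorded as the IV of the noise in that place. The old IV there is lost, as on the disk. -/
theorem write_inst (hL : L.Valid) (hi : (i : ℕ) < pws.length) (hc : L.CanWrite i B)
    (hk : (L.write i B d).ord[(k : ℕ)]? = some (i, B.divNat)) (v : Word κ) :
    write O (inst O c pws L) i B d v =
      some (inst O (c.setIV (dataBlk (c.prm k) B.modNat) v) pws (L.write i B d)) := by
  have hvek : (inst O c pws L).vek i = some (c.vol i).vek := if_pos hi
  unfold write
  rw [hvek, Option.bind_some]
  by_cases hm : (i, B.divNat) ∈ L.ord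
  · have hord : (L.write i B d).ord = L.ord := by simp [Plan.write, hm]
    have hp : (inst O c pws L).posMap i B.divNat = some (c.prm k) :=
      hL.place_eq_some c.prm (x := (i, B.divNat)) (hord ▸ hk)
    rw [hp]
    simp only [Option.map_some]
    congr 1
    refine store_inst hL hc hk v _ rfl rfl ?_ rfl ?_ ?_
    · funext i' σ'
      simp only [inst, Plan.place, hord]
    · simp only [inst, hord]
    · simp only [inst, hord]
  · have hp : (inst O c pws L).posMap i B.divNat = none := Plan.place_eq_none hm
    have hlen : (k : ℕ) = L.ord.length := by
      have hord : (L.write i B d).ord = L.ord ++ [(i, B.divNat)] := by simp [Plan.write, hm]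
      have := (hL.write hc d).nodup
      rw [← Plan.idxOf_eq_of_getElem? this hk, hord, List.idxOf_append, if_neg hm]
      simp
    rw [hp]
    simp only [newSlice_inst hm hL hlen d, Option.map_some]
    congr 1
    exact store_inst hL hc hk v _ rfl rfl rfl rfl rfl rfl

theorem write_inst_eq_none_of_le (hi : pws.length ≤ (i : ℕ)) (v : Word κ) :
    write O (inst O c pws L) i B d v = none := by
  have hvek : (inst O c pws L).vek i = none := if_neg (by omega)
  unfold write
  rw [hvek, Option.bind_none]

theorem write_inst_eq_none (hc : ¬ L.CanWrite i B) (v : Word κ) :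
    write O (inst O c pws L) i B d v = none := by
  simp only [Plan.CanWrite, not_or] at hc
  have hp : (inst O c pws L).posMap i B.divNat = none := Plan.place_eq_none hc.1
  unfold write
  rw [hp]
  simp only [newSlice_inst_eq_none hc.2, Option.map_none, Option.bind_eq_none_iff]
  exact fun _ _ => trivial

theorem read_inst (hL : L.Valid) (hi : (i : ℕ) < pws.length) (hd : L.content i B = some d) :
    read O (inst O c pws L) i B = d := by
  obtain ⟨k, hk⟩ := hL.exists_getElem? (hL.mem_of_content i B (by simp [hd]))
  have hvek : (inst O c pws L).vek i = some (c.vol i).vek := if_pos hi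
  have hp : (inst O c pws L).posMap i B.divNat = some (c.prm k) :=
    hL.place_eq_some c.prm (x := (i, B.divNat)) hk
  have hlab : L.dataLabel c.prm (fun i => (c.vol i).vek) (c.prm k) B.modNat =
      some ((c.vol i).vek, d) := by
    simp [Plan.dataLabel, hk, Plan.finProd_divNat_modNat, hd]
  unfold read
  rw [hvek, hp]
  simp [inst, hlab, overlay]

theorem step_inst (hL : L.Valid) (a : Access dev) (v : Word κ) :
    ∃ c' L', L'.Valid ∧ step O (inst O c pws L) v a = inst O c' pws L' ∧
      ∀ i B, (∀ d, a ≠ .write i B d) → L'.content i B = L.content i B := by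
  cases a with
  | write i B d =>
    by_cases hi : (i : ℕ) < pws.length
    · by_cases hc : L.CanWrite i B
      · obtain ⟨k, hk⟩ := hL.exists_rank hc d
        refine ⟨_, _, hL.write hc d, by rw [step, write_inst hL hi hc hk]; rfl, fun i' B' hne => ?_⟩
        rw [Plan.content_write, if_neg]
        rintro ⟨rfl, rfl⟩
        exact hne d rfl
      · exact ⟨c, L, hL, by rw [step, write_inst_eq_none hc]; rfl, fun _ _ _ => rfl⟩
    · exact ⟨c, L, hL, by rw [step, write_inst_eq_none_of_le (not_lt.1 hi)]; rfl, fun _ _ _ => rfl⟩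
  | read => exact ⟨c, L, hL, rfl, fun _ _ _ => rfl⟩
  | empty => exact ⟨c, L, hL, rfl, fun _ _ _ => rfl⟩

/-- For correctness it is enough that some coins give the normal form; their distribution matters
only for security. -/
theorem exec_inst (hL : L.Valid) (ops : List (Access dev)) (ivs : Fin ops.length → Word κ) :
    ∃ c' L', L'.Valid ∧ exec O (inst O c pws L) ops ivs = inst O c' pws L' ∧
      ∀ i B, (∀ d, Access.write i B d ∉ ops) → L'.content i B = L.content i B := by
  induction ops generalizing c L with
  | nil => exact ⟨c, L, hL, rfl, fun _ _ _ => rfl⟩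
  | cons a ops ih =>
    obtain ⟨c₁, L₁, hL₁, hs₁, h₁⟩ := step_inst (O := O) (c := c) (pws := pws) hL a (ivs 0)
    obtain ⟨c₂, L₂, hL₂, hs₂, h₂⟩ := ih (c := c₁) hL₁ (Fin.tail ivs)
    refine ⟨c₂, L₂, hL₂, by rw [exec, hs₁, hs₂], fun i B h => ?_⟩
    rw [h₂ i B fun d hd => h d (List.mem_cons_of_mem _ hd),
      h₁ i B fun d hd => h d (hd ▸ List.mem_cons_self)]

theorem isCorrect (dev : Device κ) : IsCorrect dev := by
  intro O c pws _ ops ivs i B d iv s hs ops' ivs' hops'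
  obtain ⟨c₁, L₁, hL₁, hs₁, -⟩ :=
    exec_inst (O := O) (c := c) (pws := pws) Plan.valid_empty ops ivs
  rw [setup_eq_inst, hs₁] at hs
  by_cases hi : (i : ℕ) < pws.length
  · by_cases hc : L₁.CanWrite i B
    · obtain ⟨k, hk⟩ := hL₁.exists_rank hc d
      rw [write_inst hL₁ hi hc hk, Option.some_inj] at hs
      subst hs
      obtain ⟨c₂, L₂, hL₂, hs₂, h₂⟩ := exec_inst (O := O)
        (c := c₁.setIV (dataBlk (c₁.prm k) B.modNat) iv) (pws := pws) (hL₁.write hc d) ops' ivs'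
      rw [hs₂]
      refine read_inst hL₂ hi ?_
      rw [h₂ i B hops', Plan.content_write, if_pos ⟨rfl, rfl⟩]
    · rw [write_inst_eq_none hc] at hs
      cases hs
  · rw [write_inst_eq_none_of_le (not_lt.1 hi)] at hs
    cases hs

/-! ### Distribution of the snapshot -/

/-- The keys and plaintexts of the cipher-encrypted blocks of a device with `n` volumes after accesses
with the effect `L`, `none` for the blocks that hold noise. -/
def Plan.lab (L : Plan dev) (n : ℕ) (c : SetupCoins dev) : Blk dev → Option (Word κ × Word κ)
  | .inl p => if (p.1 : ℕ) < n then some ((c.vol p.1).vmk, c.vmbPlain p.1 p.2) else none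
  | .inr (.inl p) =>
    if (p.1 : ℕ) < n then some ((c.vol p.1).vek, encodeEntry κ (L.place c.prm p.1 p.2)) else none
  | .inr (.inr p) => L.dataLabel c.prm (fun i => (c.vol i).vek) p.1 p.2

/-- The DMB cells, with the IVs of the noise. -/
def cells (O : Oracles dev) (c : SetupCoins dev) (pws : List (Word κ)) :
    Fin dev.maxVols → Word κ × Word dev.aeLen := fun i =>
  match pws[(i : ℕ)]? with
  | some pw => ((c.noise.cell i).1,
      O.ae (O.kdf pw c.salt) (c.noise.cell i).1 (c.vol i).vmk)
  | none => c.noise.cell i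

/-- The disk snapshot after accesses with the effect `L`, with all the IVs taken from the noise. -/
def snap (O : Oracles dev) (c : SetupCoins dev) (pws : List (Word κ)) (L : Plan dev) : Disk dev :=
  { c.noise with salt := c.salt, cell := cells O c pws }.withBlk
    fun b => overlay O (L.lab pws.length c b) (c.noise.blk b)

theorem expect_cons {n : ℕ} {α : Type*} [Fintype α] (F : α → (Fin n → α) → ℝ) :
    𝔼 f : Fin (n + 1) → α, F (f 0) (Fin.tail f) = 𝔼 a, 𝔼 f, F a f := by
  have h := expect_comp_equiv (Fin.consEquiv fun _ : Fin (n + 1) => α)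
    fun f => F (f 0) (Fin.tail f)
  rw [← h, expect_prod]
  rfl

/-- Fresh IVs for the accesses are as good as the IVs in the initial noise. -/
theorem expect_exec (O : Oracles dev) (pws : List (Word κ)) (ops : List (Access dev))
    (hops : ∀ a ∈ ops, a.Targets pws.length) {L : Plan dev} (hL : L.Valid) (g : Inst dev → ℝ) :
    𝔼 c : SetupCoins dev, 𝔼 iv : Fin ops.length → Word κ, g (exec O (inst O c pws L) ops iv) =
      𝔼 c : SetupCoins dev, g (inst O c pws (ops.foldl Plan.step L)) := by
  induction ops generalizing L with
  | nil => simp [exec]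
  | cons a ops ih =>
    have ih' := ih (fun a' ha' => hops a' (List.mem_cons_of_mem _ ha')) (hL.step a)
    have ha := hops a List.mem_cons_self
    rw [List.foldl_cons, ← ih']
    have h1 : ∀ c : SetupCoins dev,
        𝔼 iv : Fin (a :: ops).length → Word κ, g (exec O (inst O c pws L) (a :: ops) iv) =
          𝔼 v : Word κ, 𝔼 iv : Fin ops.length → Word κ,
            g (exec O (step O (inst O c pws L) v a) ops iv) := fun c =>
      expect_cons (n := ops.length) fun v iv => g (exec O (step O (inst O c pws L) v a) ops iv)
    simp only [h1]
    -- Reads, empty accesses and failing writes do not use their IV, which is averaged out.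
    have triv : (∀ (c : SetupCoins dev) v, step O (inst O c pws L) v a = inst O c pws (L.step a)) →
        𝔼 c : SetupCoins dev, 𝔼 v : Word κ, 𝔼 iv : Fin ops.length → Word κ,
            g (exec O (step O (inst O c pws L) v a) ops iv) =
          𝔼 c : SetupCoins dev, 𝔼 iv : Fin ops.length → Word κ,
            g (exec O (inst O c pws (L.step a)) ops iv) := by
      intro h
      simp only [h, Fintype.expect_const]
    cases a with
    | write i B d =>
      by_cases hc : L.CanWrite i B
      · obtain ⟨k, hk⟩ := hL.exists_rank hc d
        have h2 : ∀ (c : SetupCoins dev) v, step O (inst O c pws L) v (.write i B d) =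
            inst O (c.setIV (dataBlk (c.prm k) B.modNat) v) pws (L.write i B d) := fun c v => by
          rw [step, write_inst hL ha hc hk, Option.getD_some]
        have h3 : L.step (.write i B d) = L.write i B d := if_pos hc
        simp only [h2, h3]
        -- The rank `k` depends on the plan only, so the place `c.prm k` can be resampled although
        -- it varies with `c`.
        have h4 := expect_setIV_data k B.modNat fun c : SetupCoins dev =>
          𝔼 iv : Fin ops.length → Word κ, g (exec O (inst O c pws (L.write i B d)) ops iv)
        rw [← h4]
      · refine triv fun c v => ?_
        rw [step, write_inst_eq_none hc, Option.getD_none, Plan.step, if_neg hc]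
    | read => exact triv fun _ _ => rfl
    | empty => exact triv fun _ _ => rfl

/-- Exchanges the IVs in the headers of the first `n` volumes with those of the noise. -/
def swapIVs (n : ℕ) (x : SetupCoins dev × CloseCoins dev) : SetupCoins dev × CloseCoins dev :=
  ({ x.1 with
      noise :=
        { x.1.noise with
          cell := fun i =>
            (if (i : ℕ) < n then (x.1.vol i).cellIV else (x.1.noise.cell i).1, (x.1.noise.cell i).2)
          vmb := fun i j =>
            (if (i : ℕ) < n then (x.1.vol i).vmbIV j else (x.1.noise.vmb i j).1,
              (x.1.noise.vmb i j).2)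
          posMap := fun i σ =>
            (if (i : ℕ) < n then x.2 i σ else (x.1.noise.posMap i σ).1, (x.1.noise.posMap i σ).2) }
      vol := fun i =>
        { x.1.vol i with
          cellIV := if (i : ℕ) < n then (x.1.noise.cell i).1 else (x.1.vol i).cellIV
          vmbIV := fun j => if (i : ℕ) < n then (x.1.noise.vmb i j).1 else (x.1.vol i).vmbIV j } },
    fun i σ => if (i : ℕ) < n then (x.1.noise.posMap i σ).1 else x.2 i σ)

theorem swapIVs_involutive (n : ℕ) : Function.Involutive (swapIVs (dev := dev) n) := by
  rintro ⟨⟨⟨_, cell, _, vmb, posMap, _⟩, _, _, _, vol⟩, c'⟩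
  simp only [swapIVs, Prod.mk.injEq, SetupCoins.mk.injEq, Disk.mk.injEq, true_and, and_true]
  refine ⟨⟨⟨?_, ?_, ?_⟩, ?_⟩, ?_⟩
  · funext i
    by_cases h : (i : ℕ) < n <;> simp [h]
  · funext i j
    by_cases h : (i : ℕ) < n <;> simp [h]
  · funext i j
    by_cases h : (i : ℕ) < n <;> simp [h]
  · funext i
    by_cases h : (i : ℕ) < n <;> simp [h]
  · funext i j
    by_cases h : (i : ℕ) < n <;> simp [h]

/-- Every header IV of a created volume stems from the volume coins or, for the position maps, from
the closing coins; `swapIVs` moves them to the noise. The IVs of the initial position maps are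
overwritten on closing and need no exchange. -/
theorem close_inst (O : Oracles dev) (c : SetupCoins dev) (c' : CloseCoins dev)
    (pws : List (Word κ)) (L : Plan dev) :
    close O (inst O c pws L) c' = snap O (swapIVs pws.length (c, c')).1 pws L := by
  have hget : ∀ i : ℕ, pws[i]? = none ↔ ¬ i < pws.length := fun i => by simp
  have e1 : (close O (inst O c pws L) c').cell = (snap O (swapIVs pws.length (c, c')).1 pws L).cell := by
    funext i
    simp only [close, inst, initDisk, snap, cells, Disk.withBlk, swapIVs]
    rcases h : pws[(i : ℕ)]? with _ | pw
    · have := (hget i).1 h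
      simp [this]
    · have : (i : ℕ) < pws.length := by
        by_contra hn
        rw [(hget i).2 hn] at h
        cases h
      simp [this]
  have e2 : (close O (inst O c pws L) c').vmb = (snap O (swapIVs pws.length (c, c')).1 pws L).vmb := by
    funext i j
    have hpl : (swapIVs pws.length (c, c')).1.vmbPlain i = c.vmbPlain i := rfl
    simp only [close, inst, initDisk, snap, Disk.withBlk, Plan.lab, Disk.blk, hpl]
    rcases h : pws[(i : ℕ)]? with _ | pw
    · have := (hget i).1 h
      simp [this, overlay, swapIVs]
    · have : (i : ℕ) < pws.length := by
        by_contra hn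
        rw [(hget i).2 hn] at h
        cases h
      simp [this, overlay, swapIVs]
  have e3 : (close O (inst O c pws L) c').posMap =
      (snap O (swapIVs pws.length (c, c')).1 pws L).posMap := by
    funext i σ
    simp only [close, inst, initDisk, snap, Disk.withBlk, Plan.lab, Disk.blk]
    rcases h : pws[(i : ℕ)]? with _ | pw
    · have := (hget i).1 h
      simp [this, overlay, swapIVs]
    · have : (i : ℕ) < pws.length := by
        by_contra hn
        rw [(hget i).2 hn] at h
        cases h
      simp [this, overlay, swapIVs, encryptMap]
  have e4 : (close O (inst O c pws L) c').data =
      (snap O (swapIVs pws.length (c, c')).1 pws L).data := rfl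
  have e5 : (close O (inst O c pws L) c').salt =
      (snap O (swapIVs pws.length (c, c')).1 pws L).salt := rfl
  have e6 : (close O (inst O c pws L) c').dmbRest =
      (snap O (swapIVs pws.length (c, c')).1 pws L).dmbRest := rfl
  generalize close O (inst O c pws L) c' = D at *
  generalize snap O (swapIVs pws.length (c, c')).1 pws L = D' at *
  cases D
  cases D'
  simp_all

/-- The effect of an access pattern on new volumes. -/
def plan (ops : List (Access dev)) : Plan dev := ops.foldl Plan.step .empty

theorem expect_snapshot (O : Oracles dev) (pws : List (Word κ)) (ops : List (Access dev))
    (hops : ∀ a ∈ ops, a.Targets pws.length) (g : Disk dev → ℝ) :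
    𝔼 c : SetupCoins dev, 𝔼 iv : Fin ops.length → Word κ, 𝔼 c' : CloseCoins dev,
        g (close O (exec O (setup O c pws) ops iv) c') =
      𝔼 c : SetupCoins dev, g (snap O c pws (plan ops)) := by
  simp only [setup_eq_inst]
  have h1 := expect_exec O pws ops hops Plan.valid_empty fun s =>
    𝔼 c' : CloseCoins dev, g (close O s c')
  rw [h1]
  simp only [close_inst]
  have h2 := expect_comp_involutive (swapIVs_involutive (dev := dev) pws.length) fun x =>
    g (snap O x.1 pws (plan ops))
  rw [expect_prod, expect_prod] at h2
  simp only [Fintype.expect_const] at h2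
  exact h2

/-! ### Aligning the two cases -/

/-- A challenge, with the access patterns reduced to their effects, and with a permutation that aligns
the allocation of physical slices to the decoy volumes. -/
structure Duel (dev : Device κ) where
  pws : List (Word κ)
  /-- the hidden volume -/
  hidden : Fin dev.maxVols
  plan₀ : Plan dev
  plan₁ : Plan dev
  align : Equiv.Perm (Fin dev.numSlices)
  hidden_eq : (hidden : ℕ) = pws.length
  valid₀ : plan₀.Valid
  valid₁ : plan₁.Valid
  inFirst₀ : plan₀.InFirst (pws.length + 1)
  inFirst₁ : plan₁.InFirst pws.length
  content_eq : ∀ i : Fin dev.maxVols, (i : ℕ) < pws.length → plan₀.content i = plan₁.content i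
  mem_iff : ∀ x : Fin dev.maxVols × Fin dev.numSlices, (x.1 : ℕ) < pws.length →
    (x ∈ plan₀.ord ↔ x ∈ plan₁.ord)
  align_spec : ∀ (k : Fin dev.numSlices) x, plan₁.ord[(k : ℕ)]? = some x →
    plan₀.ord[(align k : ℕ)]? = some x

/-- Sending the rank of a slice in `L₁` to its rank in `L₀` is an injection of the used ranks, and
on a finite set it extends to a permutation. -/
theorem Plan.exists_align {L₀ L₁ : Plan dev} (h₀ : L₀.Valid) (h₁ : L₁.Valid)
    (h : ∀ x ∈ L₁.ord, x ∈ L₀.ord) :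
    ∃ τ : Equiv.Perm (Fin dev.numSlices), ∀ (k : Fin dev.numSlices) x,
      L₁.ord[(k : ℕ)]? = some x → L₀.ord[(τ k : ℕ)]? = some x := by
  classical
  have hex : ∀ k : Fin dev.numSlices, ∃ k' : Fin dev.numSlices, ∀ x,
      L₁.ord[(k : ℕ)]? = some x → L₀.ord[(k' : ℕ)]? = some x := by
    intro k
    rcases hk : L₁.ord[(k : ℕ)]? with _ | x
    -- For an unused rank the value is arbitrary: only the used ranks enter the extension.
    · exact ⟨k, fun x hx => by cases hx⟩
    · obtain ⟨k', hk'⟩ := h₀.exists_getElem? (h x (List.mem_of_getElem? hk))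
      exact ⟨k', fun y hy => by rw [hk', hy]⟩
  choose f hf using hex
  obtain ⟨g, hg⟩ := Finset.exists_equiv_extend_of_card_eq (α := Fin dev.numSlices)
    (t := (Finset.univ : Finset (Fin dev.numSlices))) (by simp)
    (s := {k | (k : ℕ) < L₁.ord.length}) (f := f) (Finset.subset_univ _) (by
      intro k hk k' hk' hkk
      simp only [Finset.coe_filter, Finset.mem_univ, true_and, Set.mem_ofPred_eq] at hk hk'
      have e := hf k _ (List.getElem?_eq_getElem hk)
      have e' := hf k' _ (List.getElem?_eq_getElem hk')
      rw [hkk, e', Option.some_inj] at e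
      exact Fin.ext ((List.Nodup.getElem_inj_iff h₁.nodup).1 e).symm)
  refine ⟨g.trans (Equiv.subtypeUnivEquiv fun x => Finset.mem_univ x), fun k x hx => ?_⟩
  have : (g.trans (Equiv.subtypeUnivEquiv fun x => Finset.mem_univ x)) k = f k :=
    hg k (by simpa using (List.getElem?_eq_some_iff.1 hx).1)
  rw [this]
  exact hf k x hx

theorem exists_duel (ch : Challenge dev) :
    ∃ d : Duel dev, d.pws = ch.pws ∧ d.plan₀ = plan ch.ops₀ ∧ d.plan₁ = plan ch.ops₁ := by
  have valid : ∀ ops, (plan ops : Plan dev).Valid := fun ops => Plan.valid_empty.foldl ops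
  have tight : ∀ ops, (plan ops : Plan dev).Tight := fun ops =>
    Plan.Tight.foldl (fun _ h => by cases h) ops
  have content : ∀ ops, (plan ops : Plan dev).content = (logical ops).content := fun ops =>
    congrArg Logical.content (Plan.toLogical_foldl Plan.valid_empty ops)
  have hin₁ : (plan ch.ops₁).InFirst ch.pws.length :=
    Plan.InFirst.foldl (fun _ h => by cases h) _ ch.targets₁
  -- Equal contents up to the default zero, together with equal sets of written blocks, give
  -- equality as optional values.
  have hcontent : ∀ i : Fin dev.maxVols, (i : ℕ) < ch.pws.length →
      (plan ch.ops₀).content i = (plan ch.ops₁).content i := by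
    intro i hi
    funext B
    have h1 := ch.same_content i hi B
    have h2 := Set.ext_iff.1 (ch.same_written i hi) B
    rw [content, content]
    simp only [Set.mem_ofPred_eq] at h2
    generalize (logical ch.ops₀).content i B = o₀ at *
    generalize (logical ch.ops₁).content i B = o₁ at *
    cases o₀ <;> cases o₁ <;> simp_all
  -- A slice is in use exactly if one of its blocks has been written, so equal written blocks give
  -- equal sets of decoy slices.
  have hmem : ∀ x : Fin dev.maxVols × Fin dev.numSlices, (x.1 : ℕ) < ch.pws.length →
      (x ∈ (plan ch.ops₀).ord ↔ x ∈ (plan ch.ops₁).ord) := by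
    rintro ⟨i, σ⟩ hi
    constructor
    · intro hx
      obtain ⟨B, hB, hs⟩ := tight _ _ hx
      rw [hcontent i hi] at hs
      have := (valid _).mem_of_content _ _ hs
      rwa [hB] at this
    · intro hx
      obtain ⟨B, hB, hs⟩ := tight _ _ hx
      rw [← hcontent i hi] at hs
      have := (valid _).mem_of_content _ _ hs
      rwa [hB] at this
  obtain ⟨τ, hτ⟩ := Plan.exists_align (valid ch.ops₀) (valid ch.ops₁)
    fun x hx => (hmem x (hin₁ x hx)).2 hx
  exact ⟨{  pws := ch.pws
            hidden := ⟨ch.pws.length, ch.length_lt⟩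
            plan₀ := plan ch.ops₀
            plan₁ := plan ch.ops₁
            align := τ
            hidden_eq := rfl
            valid₀ := valid _
            valid₁ := valid _
            inFirst₀ := Plan.InFirst.foldl (fun _ h => by cases h) _ ch.targets₀
            inFirst₁ := hin₁
            content_eq := hcontent
            mem_iff := hmem
            align_spec := hτ }, rfl, rfl, rfl⟩

/-- The secrets of the hidden volume: the password, the key derived from it, and the coins of the
volume. -/
abbrev Secret (dev : Device κ) : Type := Word κ × Word κ × VolCoins dev

namespace Duel

variable (d : Duel dev)

/-- The coins of the setup in the case with the hidden volume. -/
def coins₀ (c : SetupCoins dev) (h : Secret dev) : SetupCoins dev :=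
  { c with vol := Function.update c.vol d.hidden h.2.2 }

/-- The coins of the setup in the case without the hidden volume. -/
def coins₁ (c : SetupCoins dev) : SetupCoins dev :=
  { c with prm := d.align.trans c.prm }

def lab₀ (c : SetupCoins dev) (h : Secret dev) : Blk dev → Option (Word κ × Word κ) :=
  d.plan₀.lab (d.pws.length + 1) (d.coins₀ c h)

def lab₁ (c : SetupCoins dev) : Blk dev → Option (Word κ × Word κ) :=
  d.plan₁.lab d.pws.length (d.coins₁ c)

def disk₀ (O : Oracles dev) (c : SetupCoins dev) (h : Secret dev) : Disk dev :=
  snap O (d.coins₀ c h) (d.pws ++ [h.1]) d.plan₀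

def disk₁ (O : Oracles dev) (c : SetupCoins dev) : Disk dev :=
  snap O (d.coins₁ c) d.pws d.plan₁

variable {d} {c : SetupCoins dev} {h : Secret dev}

theorem ne_hidden {i : Fin dev.maxVols} (hi : (i : ℕ) < d.pws.length) : i ≠ d.hidden := by
  rintro rfl
  exact hi.ne d.hidden_eq

theorem eq_hidden {i : Fin dev.maxVols} (hi : (i : ℕ) < d.pws.length + 1)
    (hi' : ¬ (i : ℕ) < d.pws.length) : i = d.hidden :=
  Fin.ext (by rw [d.hidden_eq]; omega)

theorem coins₀_vol {i : Fin dev.maxVols} (hi : (i : ℕ) < d.pws.length) :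
    (d.coins₀ c h).vol i = c.vol i :=
  Function.update_of_ne (ne_hidden hi) _ _

theorem coins₀_vol_hidden : (d.coins₀ c h).vol d.hidden = h.2.2 := Function.update_self _ _ _

theorem place_eq {i : Fin dev.maxVols} (hi : (i : ℕ) < d.pws.length) (σ : Fin dev.numSlices) :
    d.plan₀.place c.prm i σ = d.plan₁.place (d.align.trans c.prm) i σ := by
  by_cases hx : (i, σ) ∈ d.plan₁.ord
  · obtain ⟨k, hk⟩ := d.valid₁.exists_getElem? hx
    exact (d.valid₀.place_eq_some c.prm (d.align_spec k _ hk)).trans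
      (d.valid₁.place_eq_some (d.align.trans c.prm) hk).symm
  · rw [Plan.place_eq_none hx, Plan.place_eq_none]
    rwa [d.mem_iff (i, σ) hi]

theorem vmbPlain_eq {i : Fin dev.maxVols} (hi : (i : ℕ) < d.pws.length) :
    (d.coins₀ c h).vmbPlain i = (d.coins₁ c).vmbPlain i := by
  have hp : (d.coins₀ c h).prevVmk i = (d.coins₁ c).prevVmk i := by
    simp only [SetupCoins.prevVmk]
    split_ifs
    · rfl
    · rw [coins₀_vol (by simp only; omega)]
      rfl
  simp only [SetupCoins.vmbPlain, hp, coins₀_vol hi]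
  rfl

/-- The two cases differ only in the blocks of the hidden volume. -/
theorem lab_cases (b : Blk dev) : d.lab₀ c h b = d.lab₁ c b ∨
    d.lab₁ c b = none ∧ ∃ x, d.lab₀ c h b = some x ∧ (x.1 = h.2.2.vmk ∨ x.1 = h.2.2.vek) := by
  rcases b with ⟨i, j⟩ | ⟨i, σ⟩ | ⟨ψ, j⟩
  · simp only [lab₀, lab₁, Plan.lab]
    by_cases hi : (i : ℕ) < d.pws.length
    · left
      rw [if_pos hi, if_pos (by omega), coins₀_vol hi, vmbPlain_eq hi]
      rfl
    · by_cases hi' : (i : ℕ) < d.pws.length + 1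
      · right
        rw [if_neg hi, if_pos hi']
        refine ⟨rfl, _, rfl, Or.inl ?_⟩
        rw [eq_hidden hi' hi, coins₀_vol_hidden]
      · left
        rw [if_neg hi, if_neg hi']
  · simp only [lab₀, lab₁, Plan.lab]
    by_cases hi : (i : ℕ) < d.pws.length
    · left
      rw [if_pos hi, if_pos (by omega), coins₀_vol hi]
      exact congrArg (fun y => some ((c.vol i).vek, encodeEntry κ y)) (place_eq hi σ)
    · by_cases hi' : (i : ℕ) < d.pws.length + 1
      · right
        rw [if_neg hi, if_pos hi']
        refine ⟨rfl, _, rfl, Or.inr ?_⟩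
        rw [eq_hidden hi' hi, coins₀_vol_hidden]
      · left
        rw [if_neg hi, if_neg hi']
  · simp only [lab₀, lab₁, Plan.lab, Plan.dataLabel]
    set k₁ : Fin dev.numSlices := d.align.symm (c.prm.symm ψ) with hk₁
    have hk : (d.coins₁ c).prm.symm ψ = k₁ := rfl
    have hk₀ : (d.coins₀ c h).prm.symm ψ = d.align k₁ := by
      rw [hk₁, Equiv.apply_symm_apply]
      rfl
    rw [hk, hk₀]
    rcases hx : d.plan₁.ord[(k₁ : ℕ)]? with _ | x
    · rcases hx₀ : d.plan₀.ord[(d.align k₁ : ℕ)]? with _ | x₀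
      · exact Or.inl rfl
      · have hm := List.mem_of_getElem? hx₀
        by_cases hi : (x₀.1 : ℕ) < d.pws.length
        -- A decoy slice cannot occur here: it would have a rank `k'` in `plan₁` aligned with the
        -- same rank in `plan₀`, hence `k' = k₁`, which is unused in `plan₁`.
        · obtain ⟨k', hk'⟩ := d.valid₁.exists_getElem? ((d.mem_iff x₀ hi).1 hm)
          have h' := d.align_spec k' _ hk'
          have : d.align k' = d.align k₁ := Fin.ext (by
            rw [← Plan.idxOf_eq_of_getElem? d.valid₀.nodup h',
              ← Plan.idxOf_eq_of_getElem? d.valid₀.nodup hx₀])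
          rw [d.align.injective this, hx] at hk'
          cases hk'
        · have hhid := eq_hidden (d.inFirst₀ _ hm) hi
          rw [Option.bind_some, Option.bind_none]
          rcases hc : d.plan₀.content x₀.1 (finProdFinEquiv (x₀.2, j)) with _ | y
          · exact Or.inl rfl
          · refine Or.inr ⟨rfl, _, rfl, Or.inr ?_⟩
            simp only [hhid, coins₀_vol_hidden]
    · left
      have hi := d.inFirst₁ x (List.mem_of_getElem? hx)
      rw [d.align_spec _ _ hx, Option.bind_some, Option.bind_some, d.content_eq _ hi]
      simp only [coins₀_vol hi]
      rfl

end Duel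

/-! ### Reprogramming the oracles -/

section Patch

open Classical in
/-- The ideal cipher `C`, reprogrammed in such a way that the block `b` with the label `(key, x)` and
the noise `(iv, y)` becomes the encryption of `x`: the values `y` and `C key iv x` are exchanged. -/
noncomputable def patchCipher (C : Word κ → Word κ → Equiv.Perm (Word κ))
    (lab : Blk dev → Option (Word κ × Word κ)) (ν : Blk dev → Word κ × Word κ)
    (key iv : Word κ) : Equiv.Perm (Word κ) :=
  -- When the IVs are distinct, at most one block qualifies and the choice is forced.
  if H : ∃ p : Blk dev × Word κ, lab p.1 = some (key, p.2) ∧ (ν p.1).1 = iv then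
    Equiv.swap (ν H.choose.1).2 (C key iv H.choose.2) * C key iv
  else C key iv

variable {C : Word κ → Word κ → Equiv.Perm (Word κ)} {lab : Blk dev → Option (Word κ × Word κ)}
  {ν : Blk dev → Word κ × Word κ}

theorem patchCipher_of_lab (hν : Function.Injective fun b => (ν b).1) {b : Blk dev}
    {x : Word κ × Word κ} (hb : lab b = some x) :
    patchCipher C lab ν x.1 (ν b).1 =
      Equiv.swap (ν b).2 (C x.1 (ν b).1 x.2) * C x.1 (ν b).1 := by
  have H : ∃ p : Blk dev × Word κ, lab p.1 = some (x.1, p.2) ∧ (ν p.1).1 = (ν b).1 :=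
    ⟨(b, x.2), hb, rfl⟩
  rw [patchCipher, dif_pos H]
  have h1 : H.choose.1 = b := hν H.choose_spec.2
  have h2 : H.choose.2 = x.2 := by
    have h := H.choose_spec.1
    rw [h1, hb, Option.some_inj] at h
    exact (congrArg Prod.snd h).symm
  rw [h1, h2]

theorem patchCipher_of_forall {key iv : Word κ}
    (h : ∀ b x, lab b = some (key, x) → (ν b).1 ≠ iv) : patchCipher C lab ν key iv = C key iv :=
  dif_neg fun ⟨p, h1, h2⟩ => h p.1 p.2 h1 h2

/-- After the first patch `x` is encrypted to the old noise, while the new noise is the old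
ciphertext. The second patch thus exchanges the same two values and undoes the first. -/
theorem patchCipher_patchCipher (hν : Function.Injective fun b => (ν b).1)
    {ν' : Blk dev → Word κ × Word κ} (hiv : ∀ b, (ν' b).1 = (ν b).1)
    (hν' : ∀ b x, lab b = some x → (ν' b).2 = C x.1 (ν b).1 x.2) :
    patchCipher (patchCipher C lab ν) lab ν' = C := by
  funext key iv
  by_cases H : ∃ b x, lab b = some (key, x) ∧ (ν b).1 = iv
  · obtain ⟨b, x, hb, rfl⟩ := H
    have h1 := patchCipher_of_lab (C := patchCipher C lab ν) (ν := ν')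
      (by simpa only [hiv] using hν) hb
    have h2 := patchCipher_of_lab (C := C) hν hb
    rw [hiv] at h1
    simp only at h1 h2
    rw [h1, h2, hν' b _ hb]
    simp only [Equiv.Perm.coe_mul, Function.comp_apply, Equiv.swap_apply_right]
    rw [← mul_assoc, Equiv.swap_comm, Equiv.swap_mul_self, one_mul]
  · push Not at H
    rw [patchCipher_of_forall (by simpa only [hiv] using H), patchCipher_of_forall H]

/-- The injections `A`, reprogrammed at `(key, iv)` by exchanging `y` and the value of `x`. -/
noncomputable def patchAE {a : ℕ} (A : Word κ → Word κ → (Word κ ↪ Word a)) (key iv : Word κ)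
    (y : Word a) (x : Word κ) (key' iv' : Word κ) : Word κ ↪ Word a :=
  if key' = key ∧ iv' = iv then
    (A key' iv').trans (Equiv.swap y (A key' iv' x)).toEmbedding
  else A key' iv'

theorem patchAE_patchAE {a : ℕ} (A : Word κ → Word κ → (Word κ ↪ Word a)) (key iv : Word κ)
    (y : Word a) (x : Word κ) :
    patchAE (patchAE A key iv y x) key iv (A key iv x) x = A := by
  funext key' iv'
  by_cases h : key' = key ∧ iv' = iv
  · obtain ⟨rfl, rfl⟩ := h
    ext1 z
    simp only [patchAE, and_self, if_true, Function.Embedding.trans_apply,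
      Equiv.toEmbedding_apply, Equiv.swap_apply_right]
    rw [Equiv.swap_comm, Equiv.swap_apply_self]
  · simp [patchAE, h]

theorem patchAE_same {a : ℕ} (A : Word κ → Word κ → (Word κ ↪ Word a)) (key iv : Word κ)
    (y : Word a) (x : Word κ) : patchAE A key iv y x key iv x = y := by
  simp [patchAE]

end Patch

/-- The coins with another initial noise. -/
def SetupCoins.withNoise (c : SetupCoins dev) (D : Disk dev) : SetupCoins dev :=
  { c with noise := D }

namespace Duel

variable (d : Duel dev)

/-- The labels of the blocks of the hidden volume. -/
def hiddenLab (c : SetupCoins dev) (h : Secret dev) (b : Blk dev) : Option (Word κ × Word κ) :=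
  match d.lab₁ c b with
  | some _ => none
  | none => d.lab₀ c h b

/-- The noise with the hidden volume embedded. -/
def embed (O : Oracles dev) (c : SetupCoins dev) (h : Secret dev) : Disk dev :=
  { c.noise with
    cell := Function.update c.noise.cell d.hidden ((c.noise.cell d.hidden).1,
      O.ae (O.kdf h.1 c.salt) (c.noise.cell d.hidden).1 h.2.2.vmk) }.withBlk
    fun b => overlay O (d.hiddenLab c h b) (c.noise.blk b)

/-- The oracles, the coins of the setup and the secrets of the hidden volume. -/
abbrev World (dev : Device κ) : Type := Oracles dev × SetupCoins dev × Secret dev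

/-- Exchanges the noise in the place of the hidden volume with the answers of the oracles. -/
noncomputable def reprogram (x : World dev) : World dev :=
  ({  kdf := x.1.kdf
      cipher := patchCipher x.1.cipher (d.hiddenLab x.2.1 x.2.2) x.2.1.noise.blk
      ae := patchAE x.1.ae (x.1.kdf x.2.2.1 x.2.1.salt) (x.2.1.noise.cell d.hidden).1
        (x.2.1.noise.cell d.hidden).2 x.2.2.2.2.vmk },
    x.2.1.withNoise (d.embed x.1 x.2.1 x.2.2), x.2.2)

/-- Exchanges the key that is derived from the hidden password with an independent one. -/
def swapKEK (x : World dev) : World dev :=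
  ({ x.1 with kdf := fun pw salt =>
      if pw = x.2.2.1 ∧ salt = x.2.1.salt then x.2.2.2.1 else x.1.kdf pw salt },
    x.2.1, x.2.2.1, x.1.kdf x.2.2.1 x.2.1.salt, x.2.2.2.2)

theorem swapKEK_involutive : Function.Involutive (swapKEK (dev := dev)) := by
  rintro ⟨⟨kdf, cipher, ae⟩, c, P, K, v⟩
  simp only [swapKEK, and_self, if_true, Prod.mk.injEq, Oracles.mk.injEq, and_true]
  funext pw salt
  by_cases h : pw = P ∧ salt = c.salt
  · simp [h]
  · simp [h]

/-- The IVs of the blocks are distinct. -/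
def FreshIVs (c : SetupCoins dev) : Prop := Function.Injective fun b => (c.noise.blk b).1

variable {d} {O : Oracles dev} {c : SetupCoins dev} {h : Secret dev}

theorem overlay_fst (O : Oracles dev) (lab : Option (Word κ × Word κ)) (ν : Word κ × Word κ) :
    (overlay O lab ν).1 = ν.1 := by
  cases lab <;> rfl

theorem hiddenLab_key {b : Blk dev} {x : Word κ × Word κ} (hb : d.hiddenLab c h b = some x) :
    x.1 = h.2.2.vmk ∨ x.1 = h.2.2.vek := by
  unfold hiddenLab at hb
  rcases h1 : d.lab₁ c b with _ | y
  · rw [h1] at hb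
    rcases lab_cases (d := d) (c := c) (h := h) b with h2 | ⟨-, z, hz, hk⟩
    · rw [h2, h1] at hb
      cases hb
    · rw [hz, Option.some_inj] at hb
      exact hb ▸ hk
  · rw [h1] at hb
    cases hb

/-- The reprogrammed oracles return the old noise at the hidden places, so embedding the hidden
volume with them restores it. Distinct IVs ensure that no two blocks compete for the same
permutation. -/
theorem embed_reprogram (hc : FreshIVs c) :
    d.embed (d.reprogram (O, c, h)).1 (d.reprogram (O, c, h)).2.1 h = c.noise := by
  have hcell : (d.embed (d.reprogram (O, c, h)).1 (d.reprogram (O, c, h)).2.1 h).cell =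
      c.noise.cell := by
    funext i
    by_cases hi : i = d.hidden
    · subst hi
      simp [embed, reprogram, Disk.withBlk, SetupCoins.withNoise, patchAE_same]
    · simp [embed, reprogram, Disk.withBlk, SetupCoins.withNoise, hi]
  have hblk : (d.embed (d.reprogram (O, c, h)).1 (d.reprogram (O, c, h)).2.1 h).blk =
      c.noise.blk := by
    funext b
    have hlab : d.hiddenLab (d.reprogram (O, c, h)).2.1 h b = d.hiddenLab c h b := rfl
    have hν : (d.reprogram (O, c, h)).2.1.noise.blk b =
        overlay O (d.hiddenLab c h b) (c.noise.blk b) := by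
      simp [reprogram, SetupCoins.withNoise, embed]
    rw [embed, Disk.blk_withBlk, hlab, hν]
    rcases hb : d.hiddenLab c h b with _ | x
    · rfl
    · have := patchCipher_of_lab (C := O.cipher) (lab := d.hiddenLab c h) hc hb
      simp only [overlay, reprogram]
      rw [this]
      simp
  have hrest : (d.embed (d.reprogram (O, c, h)).1 (d.reprogram (O, c, h)).2.1 h).dmbRest =
      c.noise.dmbRest := rfl
  have hsalt : (d.embed (d.reprogram (O, c, h)).1 (d.reprogram (O, c, h)).2.1 h).salt =
      c.noise.salt := rfl
  rw [← Disk.withBlk_blk (d.embed _ _ h), hblk, ← Disk.withBlk_blk c.noise]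
  simp only [Disk.withBlk, hcell, hrest, hsalt]
  rfl

theorem reprogram_reprogram (hc : FreshIVs c) :
    d.reprogram (d.reprogram (O, c, h)) = (O, c, h) := by
  have h1 := embed_reprogram (d := d) (O := O) (h := h) hc
  refine Prod.ext ?_ (Prod.ext ?_ rfl)
  · obtain ⟨kdf, cipher, ae⟩ := O
    have e1 : patchCipher (patchCipher cipher (d.hiddenLab c h) c.noise.blk) (d.hiddenLab c h)
        (fun b => overlay ⟨kdf, cipher, ae⟩ (d.hiddenLab c h b) (c.noise.blk b)) = cipher := by
      refine patchCipher_patchCipher hc (fun b => overlay_fst _ _ _) fun b x hb => ?_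
      rw [hb]
      rfl
    have e2 := patchAE_patchAE ae (kdf h.1 c.salt) (c.noise.cell d.hidden).1
      (c.noise.cell d.hidden).2 h.2.2.vmk
    have e3 : (d.embed ⟨kdf, cipher, ae⟩ c h).cell d.hidden = ((c.noise.cell d.hidden).1,
        ae (kdf h.1 c.salt) (c.noise.cell d.hidden).1 h.2.2.vmk) := by
      simp [embed, Disk.withBlk]
    have e4 : (d.embed ⟨kdf, cipher, ae⟩ c h).blk =
        fun b => overlay ⟨kdf, cipher, ae⟩ (d.hiddenLab c h b) (c.noise.blk b) := by
      simp [embed]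
    -- The labels do not involve the noise, which is the only part of the coins that reprogramming
    -- changes.
    have e5 : ∀ D, d.hiddenLab (c.withNoise D) h = d.hiddenLab c h := fun D => rfl
    simp only [reprogram, e5, Oracles.mk.injEq, true_and]
    simp only [SetupCoins.withNoise, e3, e4, e1, e2, and_self]
  · exact congrArg c.withNoise h1

/-- The disk with the hidden volume is what the scheme without it makes of other noise. -/
theorem disk₀_eq (O : Oracles dev) (c : SetupCoins dev) (h : Secret dev) :
    d.disk₀ O c h = d.disk₁ O (c.withNoise (d.embed O c h)) := by
  have hblk : ∀ b, overlay O (d.lab₀ c h b) (c.noise.blk b) =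
      overlay O (d.lab₁ c b) (overlay O (d.hiddenLab c h b) (c.noise.blk b)) := by
    intro b
    rcases h1 : d.lab₁ c b with _ | x
    · simp [hiddenLab, h1, overlay]
    · rcases lab_cases (d := d) (c := c) (h := h) b with h2 | ⟨h2, -⟩
      · simp [hiddenLab, h2, h1, overlay]
      · rw [h1] at h2
        cases h2
  have hcells : cells O (d.coins₀ c h) (d.pws ++ [h.1]) =
      cells O (d.coins₁ (c.withNoise (d.embed O c h))) d.pws := by
    funext i
    by_cases hi : (i : ℕ) < d.pws.length
    · have hne : i ≠ d.hidden := ne_hidden hi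
      have hvol : (d.coins₀ c h).vol i = c.vol i := coins₀_vol hi
      simp only [cells, List.getElem?_append_left hi, List.getElem?_eq_getElem hi, hvol]
      simp [coins₀, coins₁, SetupCoins.withNoise, embed, Disk.withBlk, hne]
    · by_cases hi' : i = d.hidden
      · subst hi'
        have hvol : (d.coins₀ c h).vol d.hidden = h.2.2 := coins₀_vol_hidden
        simp only [cells, d.hidden_eq, List.getElem?_concat_length, hvol,
          List.getElem?_eq_none le_rfl]
        simp [coins₀, coins₁, SetupCoins.withNoise, embed, Disk.withBlk]
      · have hlt : d.pws.length < i := lt_of_le_of_ne (not_lt.1 hi) fun he =>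
          hi' (Fin.ext (he.symm.trans d.hidden_eq.symm))
        rw [cells, cells, List.getElem?_eq_none (by simp; omega),
          List.getElem?_eq_none (by omega)]
        simp [coins₀, coins₁, SetupCoins.withNoise, embed, Disk.withBlk, hi']
  have hν : (c.withNoise (d.embed O c h)).noise.blk =
      fun b => overlay O (d.hiddenLab c h b) (c.noise.blk b) := by
    simp [SetupCoins.withNoise, embed]
  have h0 : d.plan₀.lab (d.pws ++ [h.1]).length (d.coins₀ c h) = d.lab₀ c h := by
    rw [List.length_append]
    rfl
  have h1 : d.plan₁.lab d.pws.length (d.coins₁ (c.withNoise (d.embed O c h))) = d.lab₁ c := rfl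
  have h2 : (d.coins₁ (c.withNoise (d.embed O c h))).noise.blk =
      fun b => overlay O (d.hiddenLab c h b) (c.noise.blk b) := hν
  have h3 : (d.coins₀ c h).noise.blk = c.noise.blk := rfl
  rw [disk₀, disk₁, snap, snap, h0, h1, h2, h3, hcells]
  simp only [hblk]
  rfl

/-- The hidden password and the independent key differ from those of the decoy volumes, and no IV is
used twice. -/
structure Good (d : Duel dev) (x : World dev) : Prop where
  freshIVs : FreshIVs x.2.1
  pw_notMem : x.2.2.1 ∉ d.pws
  kek_notMem : x.2.2.2.1 ∉ d.pws.map fun pw => x.1.kdf pw x.2.1.salt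

/-- The correspondence between the case without and the case with the hidden volume. -/
noncomputable def bridge (d : Duel dev) (x : World dev) : World dev := d.reprogram (swapKEK x)

/-- Both factors can be undone: `swapKEK` is an involution, and `reprogram` undoes itself when the
IVs are distinct, a condition that `swapKEK` does not touch. -/
theorem bridge_injOn (d : Duel dev) : Set.InjOn d.bridge {x | d.Good x} := by
  have hinv : ∀ x, d.Good x → swapKEK (d.reprogram (d.bridge x)) = x := by
    intro x hx
    rw [bridge, reprogram_reprogram (c := (swapKEK x).2.1) hx.freshIVs]
    exact swapKEK_involutive x
  intro x hx y hy hxy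
  rw [← hinv x hx, ← hinv y hy, hxy]

/-- The queries that involve the secrets of the hidden volume. -/
def secretQuery (P K : Word κ) (v : VolCoins dev) : Query dev → Prop
  | .kdf pw _ => pw = P
  | .enc key _ _ => key = v.vmk ∨ key = v.vek
  | .dec key _ _ => key = v.vmk ∨ key = v.vek
  | .aeEnc key _ _ => key = K
  | .aeDec key _ _ => key = K

/-- The queries to avoid in the case with the hidden volume. -/
def bad₀ (x : World dev) : Query dev → Prop :=
  secretQuery x.2.2.1 (x.1.kdf x.2.2.1 x.2.1.salt) x.2.2.2.2

/-- The queries to avoid in the case without the hidden volume. -/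
def bad₁ (h : Secret dev) : Query dev → Prop := secretQuery h.1 h.2.1 h.2.2

/-- After the exchange the key derived from the hidden password is the formerly independent key, so
the same queries are bad on both sides. -/
theorem bad₀_bridge (x : World dev) : bad₀ (d.bridge x) = bad₁ x.2.2 := by
  simp [bad₀, bad₁, bridge, reprogram, swapKEK, SetupCoins.withNoise]

theorem answer_bridge (x : World dev) (q : Query dev) (hq : ¬ bad₁ x.2.2 q) :
    (d.bridge x).1.answer q = x.1.answer q := by
  have hcipher : ∀ key iv, ¬ (key = x.2.2.2.2.vmk ∨ key = x.2.2.2.2.vek) →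
      (d.bridge x).1.cipher key iv = x.1.cipher key iv := by
    intro key iv hk
    refine patchCipher_of_forall fun b y hb => ?_
    exact absurd (hiddenLab_key hb) hk
  have hae : ∀ key iv, key ≠ x.2.2.2.1 → (d.bridge x).1.ae key iv = x.1.ae key iv := by
    intro key iv hk
    have hK : (swapKEK x).1.kdf (swapKEK x).2.2.1 (swapKEK x).2.1.salt = x.2.2.2.1 := by
      simp [swapKEK]
    refine if_neg fun hk' => hk ?_
    rw [hk'.1, hK]
  cases q with
  | kdf pw salt => exact if_neg fun (he : pw = x.2.2.1 ∧ _) => hq he.1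
  | enc key iv y => simp only [Oracles.answer, hcipher key iv hq]
  | dec key iv y => simp only [Oracles.answer, hcipher key iv hq]
  | aeEnc key iv y => simp only [Oracles.answer, hae key iv hq]
  | aeDec key iv y => simp only [Oracles.answer, hae key iv hq]

/-- By `disk₀_eq` and `embed_reprogram` the noise under the decoy volumes becomes the original one;
it remains to see that reprogramming leaves the decoy ciphertexts alone. For the cells this is due
to the distinct passwords and KEKs, for the blocks to the distinct IVs, even if cipher keys should
coincide. -/
theorem disk₀_bridge {x : World dev} (hx : d.Good x) :
    d.disk₀ (d.bridge x).1 (d.bridge x).2.1 (d.bridge x).2.2 = d.disk₁ x.1 x.2.1 := by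
  have h1 := embed_reprogram (d := d) (O := (swapKEK x).1) (c := (swapKEK x).2.1)
    (h := (swapKEK x).2.2) hx.freshIVs
  rw [disk₀_eq]
  have h2 : (d.bridge x).2.1.withNoise
      (d.embed (d.bridge x).1 (d.bridge x).2.1 (d.bridge x).2.2) = x.2.1 :=
    congrArg x.2.1.withNoise h1
  rw [h2]
  have hcells : cells (d.bridge x).1 (d.coins₁ x.2.1) d.pws = cells x.1 (d.coins₁ x.2.1) d.pws := by
    funext i
    simp only [cells]
    rcases hi : d.pws[(i : ℕ)]? with _ | pw
    · rfl
    · have hpw : pw ∈ d.pws := List.mem_of_getElem? hi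
      have hkdf : (d.bridge x).1.kdf pw x.2.1.salt = x.1.kdf pw x.2.1.salt :=
        if_neg fun (he : pw = x.2.2.1 ∧ _) => hx.pw_notMem (he.1 ▸ hpw)
      have hae : ∀ iv, (d.bridge x).1.ae (x.1.kdf pw x.2.1.salt) iv =
          x.1.ae (x.1.kdf pw x.2.1.salt) iv := by
        intro iv
        have hK : (swapKEK x).1.kdf (swapKEK x).2.2.1 (swapKEK x).2.1.salt = x.2.2.2.1 := by
          simp [swapKEK]
        refine if_neg fun hk' => hx.kek_notMem ?_
        rw [← hK, ← hk'.1]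
        exact List.mem_map_of_mem (f := fun pw => x.1.kdf pw x.2.1.salt) hpw
      have hs : (d.coins₁ x.2.1).salt = x.2.1.salt := rfl
      simp only [hs, hkdf, hae]
  have hblk : ∀ b, overlay (d.bridge x).1 (d.lab₁ x.2.1 b) (x.2.1.noise.blk b) =
      overlay x.1 (d.lab₁ x.2.1 b) (x.2.1.noise.blk b) := by
    intro b
    rcases hb : d.lab₁ x.2.1 b with _ | y
    · rfl
    · have : (d.bridge x).1.cipher y.1 (x.2.1.noise.blk b).1 =
          x.1.cipher y.1 (x.2.1.noise.blk b).1 := by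
        refine patchCipher_of_forall fun b' z hb' hiv => ?_
        -- A reprogrammed block with this IV would be the decoy block itself, which has no hidden
        -- label.
        have he : b' = b := hx.freshIVs hiv
        have hb'' : d.hiddenLab x.2.1 (swapKEK x).2.2 b = some (y.1, z) := he ▸ hb'
        rw [hiddenLab, hb] at hb''
        cases hb''
      simp only [overlay, this]
  rw [disk₁, disk₁, snap, snap, hcells]
  refine congrArg _ (funext fun b => ?_)
  exact hblk b

end Duel

/-! ### Collision and guessing probabilities -/

theorem expect_eq_word (a : Word κ) : 𝔼 w : Word κ, ind (w = a) = 1 / 2 ^ κ := by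
  rw [expect_ind_eq, card_word]

theorem expect_mem_word_le (l : List (Word κ)) :
    𝔼 w : Word κ, ind (w ∈ l) ≤ l.length * (1 / 2 ^ κ) := by
  induction l with
  | nil => simp [ind]
  | cons a l ih =>
    calc 𝔼 w : Word κ, ind (w ∈ a :: l)
        ≤ 𝔼 w : Word κ, (ind (w = a) + ind (w ∈ l)) := by
          refine expect_mono fun w => ?_
          rw [List.mem_cons]
          exact ind_or_le _ _
      _ ≤ 1 / 2 ^ κ + l.length * (1 / 2 ^ κ) := by
          rw [Finset.expect_add_distrib, expect_eq_word]
          exact add_le_add le_rfl ih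
      _ = _ := by push_cast [List.length_cons]; ring

theorem expect_vmk (f : Word κ → ℝ) : 𝔼 v : VolCoins dev, f v.vmk = 𝔼 w, f w := by
  have h := expect_resample (fun (v : VolCoins dev) (w : Word κ) => { v with vmk := w })
    (fun v => v.vmk) (fun _ _ => rfl) (fun _ _ => rfl) fun v => f v.vmk
  rw [← h]
  simp

theorem expect_vek (f : Word κ → ℝ) : 𝔼 v : VolCoins dev, f v.vek = 𝔼 w, f w := by
  have h := expect_resample (fun (v : VolCoins dev) (w : Word κ) => { v with vek := w })
    (fun v => v.vek) (fun _ _ => rfl) (fun _ _ => rfl) fun v => f v.vek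
  rw [← h]
  simp

theorem expect_secret_eq_key (key : Word κ) :
    𝔼 h : Secret dev, ind (key = h.2.2.vmk ∨ key = h.2.2.vek) ≤ 2 / 2 ^ κ := by
  have hm := (expect_vmk (dev := dev) fun w => ind (w = key)).trans (expect_eq_word key)
  have he := (expect_vek (dev := dev) fun w => ind (w = key)).trans (expect_eq_word key)
  calc 𝔼 h : Secret dev, ind (key = h.2.2.vmk ∨ key = h.2.2.vek)
      ≤ 𝔼 h : Secret dev, (ind (h.2.2.vmk = key) + ind (h.2.2.vek = key)) := by
        refine expect_mono fun h => ?_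
        rw [eq_comm (a := key), eq_comm (a := key)]
        exact ind_or_le _ _
    _ = 2 / 2 ^ κ := by
        rw [Finset.expect_add_distrib, expect_prod, expect_prod]
        simp only [Fintype.expect_const, expect_prod, hm, he]
        ring

theorem expect_secret_eq_pw (pw : Word κ) : 𝔼 h : Secret dev, ind (pw = h.1) ≤ 2 / 2 ^ κ := by
  have hle : (1 : ℝ) / 2 ^ κ ≤ 2 / 2 ^ κ := by gcongr; norm_num
  simp only [eq_comm (a := pw)]
  rw [expect_prod]
  simpa only [Fintype.expect_const, expect_eq_word] using hle

theorem expect_secret_eq_kek (key : Word κ) :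
    𝔼 h : Secret dev, ind (key = h.2.1) ≤ 2 / 2 ^ κ := by
  have hle : (1 : ℝ) / 2 ^ κ ≤ 2 / 2 ^ κ := by gcongr; norm_num
  simp only [eq_comm (a := key)]
  rw [expect_prod]
  simp only [expect_prod]
  simpa only [Fintype.expect_const, expect_eq_word] using hle

/-- The factor `2` comes from cipher queries, which can hit either of two keys; the other queries
have only one target. -/
theorem expect_bad₁_le (q : Query dev) :
    𝔼 h : Secret dev, ind (Duel.bad₁ h q) ≤ 2 / 2 ^ κ := by
  cases q with
  | kdf pw salt => exact expect_secret_eq_pw pw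
  | enc key iv x => exact expect_secret_eq_key key
  | dec key iv x => exact expect_secret_eq_key key
  | aeEnc key iv x => exact expect_secret_eq_kek key
  | aeDec key iv x => exact expect_secret_eq_kek key

theorem expect_eq_iv {b b' : Blk dev} (hb : b ≠ b') :
    𝔼 c : SetupCoins dev, ind ((c.noise.blk b).1 = (c.noise.blk b').1) = 1 / 2 ^ κ := by
  have h := expect_setIV b fun c : SetupCoins dev =>
    ind ((c.noise.blk b).1 = (c.noise.blk b').1)
  have h1 : ∀ (c : SetupCoins dev) v, ((c.setIV b v).noise.blk b).1 = v := fun c v => by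
    simp [SetupCoins.setIV]
  have h2 : ∀ (c : SetupCoins dev) v, (c.setIV b v).noise.blk b' = c.noise.blk b' := fun c v => by
    simp [SetupCoins.setIV, hb.symm]
  simp only [h1, h2, expect_eq_word, Fintype.expect_const] at h
  exact h.symm

/-- A union bound over ordered pairs of distinct blocks. The subtracted `dev.encBlocks` is kept
because it later pays for the guessing of decoy passwords and keys. -/
theorem expect_not_freshIVs_le (dev : Device κ) :
    𝔼 c : SetupCoins dev, ind (¬ Duel.FreshIVs c) ≤
      ((dev.encBlocks : ℝ) ^ 2 - dev.encBlocks) / 2 ^ κ := by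
  classical
  calc 𝔼 c : SetupCoins dev, ind (¬ Duel.FreshIVs c)
      ≤ 𝔼 c : SetupCoins dev, ∑ p ∈ (Finset.univ : Finset (Blk dev)).offDiag,
          ind ((c.noise.blk p.1).1 = (c.noise.blk p.2).1) := by
        refine expect_mono fun c => ?_
        by_cases hc : Duel.FreshIVs c
        · rw [ind_neg (not_not.2 hc)]
          exact Finset.sum_nonneg fun p _ => ind_nonneg _
        · simp only [Duel.FreshIVs, Function.Injective] at hc
          push Not at hc
          obtain ⟨b, b', he, hne⟩ := hc
          refine le_trans ?_ (Finset.single_le_sum (fun p _ => ind_nonneg _) (a := (b, b'))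
            (by simpa using hne))
          rw [ind_pos (p := (c.noise.blk b).1 = (c.noise.blk b').1) he]
          exact ind_le_one _
    _ = ∑ p ∈ (Finset.univ : Finset (Blk dev)).offDiag, (1 : ℝ) / 2 ^ κ := by
        rw [Finset.expect_sum_comm]
        exact Finset.sum_congr rfl fun p hp => expect_eq_iv (Finset.mem_offDiag.1 hp).2.2
    _ = _ := by
        rw [Finset.sum_const, Finset.offDiag_card, Finset.card_univ, card_blk, nsmul_eq_mul,
          Nat.cast_sub (Nat.le_mul_self _)]
        push_cast
        ring

/-! ### The game as an expectation -/

/-- The duel of a challenge. -/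
noncomputable def Challenge.duel (ch : Challenge dev) : Duel dev := (exists_duel ch).choose

theorem Challenge.duel_spec (ch : Challenge dev) :
    ch.duel.pws = ch.pws ∧ ch.duel.plan₀ = plan ch.ops₀ ∧ ch.duel.plan₁ = plan ch.ops₁ :=
  (exists_duel ch).choose_spec

/-- The snapshot in the case `b` of the duel. -/
def Duel.disk (d : Duel dev) (x : Duel.World dev) : Bool → Disk dev
  | false => d.disk₀ x.1 x.2.1 x.2.2
  | true => d.disk₁ x.1 x.2.1

theorem expect_coins₁ (d : Duel dev) (f : SetupCoins dev → ℝ) :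
    𝔼 c, f (d.coins₁ c) = 𝔼 c, f c := by
  let e : SetupCoins dev ≃ SetupCoins dev :=
    { toFun := d.coins₁
      invFun := fun c => { c with prm := d.align.symm.trans c.prm }
      left_inv := fun c => by simp [Duel.coins₁, ← Equiv.trans_assoc]
      right_inv := fun c => by simp [Duel.coins₁, ← Equiv.trans_assoc] }
  exact expect_comp_equiv e f

theorem expect_coins₀ (d : Duel dev) (P K : Word κ) (f : SetupCoins dev → ℝ) :
    𝔼 c, 𝔼 v, f (d.coins₀ c (P, K, v)) = 𝔼 c, f c := by
  have h := expect_resample (fun (c : SetupCoins dev) (v : VolCoins dev) => d.coins₀ c (P, K, v))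
    (fun c => c.vol d.hidden) (fun c v => by simp [Duel.coins₀]) (fun c v => by simp [Duel.coins₀]) f
  rw [← h]

/-- This puts both cases on one probability space. With the hidden volume, its coins are resampled
from the secret; without it, the shuffle is composed with the aligning permutation and the secret is
a dummy. Neither changes the distribution. -/
theorem toReal_snapshot_bind_apply (O : Oracles dev) (ch : Challenge dev) (b : Bool)
    (f : Disk dev → PMF Bool) (β : Bool) :
    (((snapshot O ch b).bind f) β).toReal =
      𝔼 c : SetupCoins dev, 𝔼 h : Secret dev, (f (ch.duel.disk (O, c, h) b) β).toReal := by
  set g : Disk dev → ℝ := fun D => (f D β).toReal with hg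
  have h0 : (((snapshot O ch b).bind f) β).toReal =
      𝔼 P : Word κ, 𝔼 c : SetupCoins dev, 𝔼 iv : Fin (ch.ops b).length → Word κ,
        𝔼 c' : CloseCoins dev,
          g (close O (exec O (setup O c (ch.passwords P b)) (ch.ops b) iv) c') := by
    change ((((PMF.uniformOfFintype (Word κ)).bind fun P =>
      (PMF.uniformOfFintype (SetupCoins dev)).bind fun c =>
      (PMF.uniformOfFintype (Fin (ch.ops b).length → Word κ)).bind fun iv =>
      (PMF.uniformOfFintype (CloseCoins dev)).bind fun c' => PMF.pure
        (close O (exec O (setup O c (ch.passwords P b)) (ch.ops b) iv) c')).bind f) β).toReal = _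
    simp only [PMF.bind_bind, PMF.pure_bind]
    simp only [toReal_uniform_bind_apply]
    rfl
  obtain ⟨hp, hp₀, hp₁⟩ := ch.duel_spec
  have htargets : ∀ P, ∀ a ∈ ch.ops b, a.Targets (ch.passwords P b).length := by
    intro P
    cases b with
    | false =>
      rw [Challenge.passwords, List.length_append]
      exact ch.targets₀
    | true => exact ch.targets₁
  have h1 : ∀ P, _ := fun P => expect_snapshot O (ch.passwords P b) (ch.ops b) (htargets P) g
  rw [h0]
  simp only [h1]
  have h2 : ∀ F : SetupCoins dev → Secret dev → ℝ,
      𝔼 c, 𝔼 h : Secret dev, F c h = 𝔼 P, 𝔼 K, 𝔼 c, 𝔼 v, F c (P, K, v) := by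
    intro F
    simp only [expect_prod]
    rw [expect_swap]
    refine Finset.expect_congr rfl fun P _ => ?_
    rw [expect_swap]
  rw [h2]
  cases b with
  | false =>
    refine Finset.expect_congr rfl fun P _ => ?_
    have h3 : ∀ K : Word κ, _ := fun K => expect_coins₀ ch.duel P K fun c =>
      g (snap O c (ch.duel.pws ++ [P]) ch.duel.plan₀)
    have h4 : 𝔼 _K : Word κ, 𝔼 c : SetupCoins dev,
        g (snap O c (ch.duel.pws ++ [P]) ch.duel.plan₀) =
        𝔼 c : SetupCoins dev, g (snap O c (ch.passwords P false) (plan (ch.ops false))) := by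
      rw [Fintype.expect_const, hp, hp₀]
      rfl
    rw [← h4]
    refine Finset.expect_congr rfl fun K _ => ?_
    rw [← h3 K]
    rfl
  | true =>
    have h3 := expect_coins₁ ch.duel fun c => g (snap O c ch.duel.pws ch.duel.plan₁)
    rw [hp, hp₁] at h3
    refine Finset.expect_congr rfl fun P _ => ?_
    have h4 : ∀ (K : Word κ) (c : SetupCoins dev) (v : VolCoins dev),
        ch.duel.disk (O, c, P, K, v) true = snap O (ch.duel.coins₁ c) ch.pws (plan ch.ops₁) := by
      intro K c v
      rw [← hp, ← hp₁]
      rfl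
    simp only [h4, Fintype.expect_const]
    exact h3.symm

theorem toReal_game_apply (A : Adversary dev) (b β : Bool) :
    (game A b β).toReal = 𝔼 x : Duel.World dev, A.ev x.1 (fun _ => False) fun r =>
      (r.2 (r.1.duel.disk x b)).ev x.1 (fun _ => False) fun a => ind (a = β) := by
  change (((PMF.uniformOfFintype (Oracles dev)).bind fun O => (A.run O).bind fun r =>
    (snapshot O r.1 b).bind fun D => (r.2 D).run O) β).toReal = _
  rw [toReal_uniform_bind_apply, expect_prod]
  refine Finset.expect_congr rfl fun O _ => ?_
  rw [OracleComp.toReal_run_bind_apply, expect_prod]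
  simp only [toReal_snapshot_bind_apply, OracleComp.toReal_run_apply]
  simp only [OracleComp.ev_expect]

/-! ### The mass common to both cases -/

/-- The choice of an adversary before the snapshot: the challenge, and how to go on. -/
abbrev Choice (dev : Device κ) : Type := Challenge dev × (Disk dev → OracleComp dev Bool)

/-- The probability that the output in the case without the hidden volume is `β`, that the world is
good for the challenge, and that no query involves the secrets of the hidden volume. -/
noncomputable def goodMass (A : Adversary dev) (β : Bool) : ℝ :=
  𝔼 x : Duel.World dev, A.ev x.1 (Duel.bad₁ x.2.2) fun r =>
    ind (r.1.duel.Good x) *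
      (r.2 (r.1.duel.disk x true)).ev x.1 (Duel.bad₁ x.2.2) fun a => ind (a = β)

theorem goodMass_le_game_true (A : Adversary dev) (β : Bool) :
    goodMass A β ≤ (game A true β).toReal := by
  rw [toReal_game_apply]
  refine expect_mono fun x => OracleComp.ev_le_ev_unrestricted _
    (fun r => OracleComp.ev_nonneg _ fun _ => ind_nonneg _) fun r => ?_
  refine (mul_le_of_le_one_left (OracleComp.ev_nonneg _ fun _ => ind_nonneg _)
    (ind_le_one _)).trans ?_
  exact OracleComp.ev_le_ev_unrestricted _ (fun _ => ind_nonneg _) fun _ => le_rfl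

/-- The bridge carries each good world to one with the same disk, the same bad queries and the same
answers to the others, so restricted runs in the two worlds agree. It depends on the challenge,
which the adversary picks adaptively, whence `OracleComp.sum_ev_le_sum_ev`. -/
theorem goodMass_le_game_false (A : Adversary dev) (β : Bool) :
    goodMass A β ≤ (game A false β).toReal := by
  have h1 : goodMass A β ≤ 𝔼 x : Duel.World dev, A.ev x.1 (Duel.bad₀ x) fun r =>
      (r.2 (r.1.duel.disk x false)).ev x.1 (Duel.bad₀ x) fun a => ind (a = β) := by
    rw [goodMass, Fintype.expect_eq_sum_div_card, Fintype.expect_eq_sum_div_card]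
    refine div_le_div_of_nonneg_right ?_ (Nat.cast_nonneg _)
    refine OracleComp.sum_ev_le_sum_ev (O₁ := fun x : Duel.World dev => x.1) (O₀ := fun x => x.1)
      (B₁ := fun x => Duel.bad₁ x.2.2) (B₀ := fun x => Duel.bad₀ x)
      (Φ := fun r : Choice dev => r.1.duel.bridge)
      (G := fun r x => r.1.duel.Good x)
      (F₁ := fun x (r : Choice dev) => ind (r.1.duel.Good x) *
        (r.2 (r.1.duel.disk x true)).ev x.1 (Duel.bad₁ x.2.2) fun a => ind (a = β))
      (F₀ := fun x (r : Choice dev) =>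
        (r.2 (r.1.duel.disk x false)).ev x.1 (Duel.bad₀ x) fun a => ind (a = β))
      (fun r => r.1.duel.bridge_injOn) (fun r x _ q => by rw [Duel.bad₀_bridge])
      (fun r x _ q hq => Duel.answer_bridge x q hq)
      (fun x r => OracleComp.ev_nonneg _ fun _ => ind_nonneg _)
      (fun x r hG => by rw [ind_neg hG, zero_mul]) (fun x r hG => ?_) A
    refine (mul_le_of_le_one_left (OracleComp.ev_nonneg _ fun _ => ind_nonneg _)
      (ind_le_one _)).trans_eq ?_
    have hdisk : r.1.duel.disk (r.1.duel.bridge x) false = r.1.duel.disk x true :=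
      Duel.disk₀_bridge hG
    rw [hdisk]
    exact (OracleComp.ev_congr_oracles (fun q => by rw [Duel.bad₀_bridge])
      (fun q hq => Duel.answer_bridge x q hq) _ _).symm
  refine h1.trans ?_
  rw [toReal_game_apply]
  refine expect_mono fun x => OracleComp.ev_le_ev_unrestricted _
    (fun r => OracleComp.ev_nonneg _ fun _ => ind_nonneg _) fun r => ?_
  exact OracleComp.ev_le_ev_unrestricted _ (fun _ => ind_nonneg _) fun _ => le_rfl

theorem goodMass_add (A : Adversary dev) :
    goodMass A true + goodMass A false =
      𝔼 x : Duel.World dev, A.ev x.1 (Duel.bad₁ x.2.2) fun r =>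
        ind (r.1.duel.Good x) *
          (r.2 (r.1.duel.disk x true)).ev x.1 (Duel.bad₁ x.2.2) fun _ => 1 := by
  rw [goodMass, goodMass, ← Finset.expect_add_distrib]
  refine Finset.expect_congr rfl fun x _ => ?_
  rw [← OracleComp.ev_add]
  congr 1
  funext r
  rw [← mul_add, ← OracleComp.ev_add]
  congr 2
  funext a
  cases a <;> simp [ind]

theorem Challenge.duel_pws_length_le (ch : Challenge dev) : ch.duel.pws.length ≤ dev.maxVols := by
  have := ch.length_lt
  rw [ch.duel_spec.1]
  omega

/-- Oracles and coins are fixed, so the decoy passwords and derived keys form fixed lists of at most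
`dev.maxVols` words, against which the secret ones are uniform. Freshness of the IVs does not depend
on the secret. -/
theorem expect_not_good_le (O : Oracles dev) (c : SetupCoins dev) (d : Duel dev)
    (hd : d.pws.length ≤ dev.maxVols) :
    𝔼 h : Secret dev, (1 - ind (d.Good (O, c, h))) ≤
      2 * dev.maxVols / 2 ^ κ + ind (¬ Duel.FreshIVs c) := by
  have hlen : (d.pws.length : ℝ) * (1 / 2 ^ κ) ≤ dev.maxVols * (1 / 2 ^ κ) := by gcongr
  have h1 : 𝔼 h : Secret dev, ind (h.1 ∈ d.pws) ≤ dev.maxVols * (1 / 2 ^ κ) := by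
    rw [expect_prod]
    simp only [Fintype.expect_const]
    exact (expect_mem_word_le _).trans hlen
  have h2 : 𝔼 h : Secret dev, ind (h.2.1 ∈ d.pws.map fun pw => O.kdf pw c.salt) ≤
      dev.maxVols * (1 / 2 ^ κ) := by
    rw [expect_prod]
    simp only [expect_prod, Fintype.expect_const]
    refine (expect_mem_word_le _).trans ?_
    rwa [List.length_map]
  calc 𝔼 h : Secret dev, (1 - ind (d.Good (O, c, h)))
      ≤ 𝔼 h : Secret dev, (ind (h.1 ∈ d.pws) +
          (ind (h.2.1 ∈ d.pws.map fun pw => O.kdf pw c.salt) + ind (¬ Duel.FreshIVs c))) := by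
        refine expect_mono fun h => ?_
        have e := ind_or_le (h.1 ∈ d.pws)
          (h.2.1 ∈ (d.pws.map fun pw => O.kdf pw c.salt) ∨ ¬ Duel.FreshIVs c)
        have e' := ind_or_le (h.2.1 ∈ d.pws.map fun pw => O.kdf pw c.salt) (¬ Duel.FreshIVs c)
        by_cases hG : d.Good (O, c, h)
        · rw [ind_pos hG]
          have := ind_nonneg (h.1 ∈ d.pws)
          have := ind_nonneg (h.2.1 ∈ d.pws.map fun pw => O.kdf pw c.salt)
          have := ind_nonneg (¬ Duel.FreshIVs c)
          linarith
        · have hor : h.1 ∈ d.pws ∨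
              (h.2.1 ∈ (d.pws.map fun pw => O.kdf pw c.salt) ∨ ¬ Duel.FreshIVs c) := by
            by_contra hn
            rw [not_or, not_or, not_not] at hn
            exact hG ⟨hn.2.2, hn.1, hn.2.1⟩
          rw [ind_pos hor] at e
          rw [ind_neg hG]
          linarith
    _ ≤ dev.maxVols * (1 / 2 ^ κ) + (dev.maxVols * (1 / 2 ^ κ) + ind (¬ Duel.FreshIVs c)) := by
        rw [Finset.expect_add_distrib, Finset.expect_add_distrib, Fintype.expect_const]
        gcongr
    _ = _ := by ring

/-- For fixed oracles and coins the snapshot without the hidden volume does not depend on the secret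
`h`, so the bad queries are guesses at an independent target. The query bound is used twice: inside
for the phase after the snapshot with the `m` queries left, outside for the phase before it, with
the failure of goodness as additive error. -/
theorem one_sub_goodMass_le {A : Adversary dev} {n : ℕ} (hA : A.MakesAtMost n) :
    1 - (goodMass A true + goodMass A false) ≤
      2 * n / 2 ^ κ + (2 * dev.maxVols / 2 ^ κ +
        ((dev.encBlocks : ℝ) ^ 2 - dev.encBlocks) / 2 ^ κ) := by
  have hsub : ∀ y : Duel.World dev → ℝ, 1 - 𝔼 x, y x = 𝔼 x, (1 - y x) := fun y => by
    rw [Finset.expect_sub_distrib, Fintype.expect_const]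
  rw [goodMass_add, hsub, expect_prod]
  simp only [expect_prod (X := SetupCoins dev)]
  refine expect_le_of_forall_le fun O => ?_
  calc _ ≤ 𝔼 c : SetupCoins dev, (2 * n / 2 ^ κ + (2 * dev.maxVols / 2 ^ κ +
          ind (¬ Duel.FreshIVs c))) := by
        refine expect_mono fun c => ?_
        have key := OracleComp.expect_one_sub_ev_le (O := O) (H := Secret dev) Duel.bad₁
          (ε := 2 / 2 ^ κ) (δ := 2 * dev.maxVols / 2 ^ κ + ind (¬ Duel.FreshIVs c))
          expect_bad₁_le (post := fun (r : Choice dev) m =>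
            ∀ D, (r.2 D).Within (fun _ _ => True) m)
          (fun h r => ind (r.1.duel.Good (O, c, h)) *
            (r.2 (r.1.duel.disk (O, c, h) true)).ev O (Duel.bad₁ h) fun _ => 1)
          (fun h r => mul_le_one₀ (ind_le_one _) (OracleComp.ev_nonneg _ fun _ => zero_le_one)
            (OracleComp.ev_le_one _ fun _ => le_rfl)) ?_ A n hA
        · refine key.trans_eq ?_
          ring
        · intro r m hr
          have hphase := OracleComp.expect_one_sub_ev_le (O := O) (H := Secret dev) Duel.bad₁
            (ε := 2 / 2 ^ κ) (δ := 0) expect_bad₁_le (post := fun _ _ => True)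
            (fun _ _ => 1) (fun _ _ => le_rfl)
            (fun _ m _ => by
              simp only [sub_self, Finset.expect_const_zero]
              positivity)
            (r.2 (r.1.duel.disk₁ O c)) m (hr _)
          have hgood := expect_not_good_le O c r.1.duel r.1.duel_pws_length_le
          calc _ ≤ 𝔼 h : Secret dev,
                ((1 - (r.2 (r.1.duel.disk₁ O c)).ev O (Duel.bad₁ h) fun _ => 1) +
                  (1 - ind (r.1.duel.Good (O, c, h)))) := by
                refine expect_mono fun h => ?_
                have e1 := ind_le_one (r.1.duel.Good (O, c, h))
                have e2 : (r.2 (r.1.duel.disk₁ O c)).ev O (Duel.bad₁ h) (fun _ => 1) ≤ 1 :=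
                  OracleComp.ev_le_one _ fun _ => le_rfl
                change 1 - _ * (r.2 (r.1.duel.disk₁ O c)).ev O (Duel.bad₁ h) (fun _ => 1) ≤ _
                -- This is `1 - a * b ≤ (1 - a) + (1 - b)` for `a, b ≤ 1`.
                nlinarith
            _ ≤ _ := by
                rw [Finset.expect_add_distrib]
                linarith
    _ ≤ _ := by
        rw [Finset.expect_add_distrib, Finset.expect_add_distrib, Fintype.expect_const,
          Fintype.expect_const]
        gcongr
        exact expect_not_freshIVs_le dev

theorem toReal_game_add (A : Adversary dev) (b : Bool) :
    (game A b true).toReal + (game A b false).toReal = 1 := by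
  have h := (game A b).tsum_coe
  rw [tsum_fintype, Fintype.sum_bool] at h
  rw [← ENNReal.toReal_add (PMF.apply_ne_top _ _) (PMF.apply_ne_top _ _), h, ENNReal.toReal_one]

/-- Every volume master block has at least three blocks. -/
theorem two_mul_maxVols_le (dev : Device κ) : 2 * dev.maxVols ≤ dev.encBlocks := by
  have : dev.maxVols * 2 ≤ dev.maxVols * (dev.vmbLen + dev.numSlices) :=
    Nat.mul_le_mul_left _ (by simp only [Device.vmbLen]; omega)
  rw [Device.encBlocks]
  omega

theorem advantage_le {A : Adversary dev} {n : ℕ} (hA : A.MakesAtMost n) :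
    advantage A ≤ 4 * (n : ℝ) / 2 ^ κ + (dev.encBlocks : ℝ) ^ 2 / 2 ^ κ := by
  have h₀t := goodMass_le_game_false A true
  have h₀f := goodMass_le_game_false A false
  have h₁t := goodMass_le_game_true A true
  have h₁f := goodMass_le_game_true A false
  have h₀ := toReal_game_add A false
  have h₁ := toReal_game_add A true
  have hδ : 1 - (goodMass A true + goodMass A false) ≤
      4 * (n : ℝ) / 2 ^ κ + (dev.encBlocks : ℝ) ^ 2 / 2 ^ κ := by
    refine (one_sub_goodMass_le hA).trans ?_
    have hT : (2 * dev.maxVols : ℝ) ≤ dev.encBlocks := by exact_mod_cast two_mul_maxVols_le dev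
    rw [← add_div, ← add_div, ← add_div]
    refine div_le_div_of_nonneg_right ?_ (by positivity)
    have : (0 : ℝ) ≤ n := Nat.cast_nonneg n
    linarith
  rw [advantage, abs_le]
  -- In either case the probability of output `true` lies between `goodMass A true` and `1 -
  -- goodMass A false`, an interval that contains both probabilities.
  constructor <;> linarith

/-! ### Asymptotic security -/

theorem negligible_of_le_polynomial {f : ℕ → ℝ} (p : Polynomial ℕ)
    (h : ∀ κ, |f κ| ≤ ((p.eval κ : ℕ) : ℝ) / 2 ^ κ) : Negligible f := by
  have hpow : Asymptotics.SuperpolynomialDecay Filter.atTop (fun κ : ℕ => (κ : ℝ))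
      fun κ : ℕ => (1 / 2 : ℝ) ^ κ := fun k =>
    tendsto_pow_const_mul_const_pow_of_lt_one k (by norm_num) (by norm_num)
  refine (hpow.polynomial_mul (p.map (Nat.castRingHom ℝ))).trans_abs_le fun κ => ?_
  refine (h κ).trans ((le_abs_self _).trans_eq ?_)
  rw [Polynomial.eval_natCast_map, one_div, inv_pow]
  rfl

theorem singleSnapshotSecure (dev : (κ : ℕ) → Device κ)
    (hT : PolyBounded fun κ => (dev κ).encBlocks) : SingleSnapshotSecure dev := by
  intro A q ⟨r, hr⟩ hA
  obtain ⟨t, ht⟩ := hT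
  -- The polynomial is the numerator of the concrete bound, with `r` bounding the queries and `t`
  -- the number of blocks.
  refine negligible_of_le_polynomial (4 * r + t ^ 2) fun κ => ?_
  have h1 : (q κ : ℝ) ≤ ((r.eval κ : ℕ) : ℝ) := by exact_mod_cast hr κ
  have h2 : ((dev κ).encBlocks : ℝ) ≤ ((t.eval κ : ℕ) : ℝ) := by exact_mod_cast ht κ
  have h3 : |advantage (A κ)| = advantage (A κ) := abs_abs _
  rw [h3]
  refine (advantage_le (hA κ)).trans ?_
  rw [← add_div]
  simp only [Polynomial.eval_add, Polynomial.eval_mul, Polynomial.eval_pow, Polynomial.eval_ofNat]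
  push_cast
  gcongr

end Shufflecake
theorem theorem1 :
    (∀ (κ : ℕ) (dev : Shufflecake.Device κ), Shufflecake.IsCorrect dev) ∧
    (∀ (κ : ℕ) (dev : Shufflecake.Device κ) (A : Shufflecake.Adversary dev) (n : ℕ),
      A.MakesAtMost n →
        Shufflecake.advantage A ≤ 4 * (n : ℝ) / 2 ^ κ + (dev.encBlocks : ℝ) ^ 2 / 2 ^ κ) ∧
    (∀ dev : (κ : ℕ) → Shufflecake.Device κ,
      Shufflecake.PolyBounded (fun κ => (dev κ).encBlocks) →
        Shufflecake.SingleSnapshotSecure dev) :=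
  ⟨fun _ => Shufflecake.isCorrect, fun _ _ _ _ => Shufflecake.advantage_le,
    Shufflecake.singleSnapshotSecure⟩
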